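/- **Setting.** Fix $K\ge 2$ actions. Loss vectors $X_1,X_2,\dots$ are i.i.d. in $[0,1]^K$ with common law $\nu$ (coordinates may be dependent). In each round $t$ a randomized algorithm picks $I_t\in\{1,\dots,K\}$ from its internal randomness, its previous actions and $X_1,\dots,X_{t-1}$, and then observes all of $X_t$. With $\mu_j=\mathbb E[X_{1,j}]$, assume there is a unique best action $i^*$ and let $\Delta_{\min}=\min_{j\ne i^*}(\mu_j-\mu_{i^*})>0$. The pseudoregret is $\operatorname{Reg}_T=\mathbb E\bigl[\sum_{t=1}^T (X_{t,I_t}-X_{t,i^*})\bigr]$. The algorithm is (event-level, pure) $\varepsilon$-DP if for every $t$, all fixed $x_{1:t},x'_{1:t}\in([0,1]^K)^t$ that differ in at most one loss vector, and every $S\subseteq\{1,\dots,K\}^t$, one has $\mathbb P((I_1,\dots,I_t)\in S\mid x_{1:t})\le e^{\varepsilon}\,\mathbb P((I_1,\dots,I_t)\in S\mid x'_{1:t})$, with probability over the internal randomness only. The *randomized-prefix softmax algorithm* with parameter $\varepsilon$ sets $\eta=\min\{\varepsilon/2,1/8\}$ and plays one action $A_r$ throughout each block $B_r=\{2^r,\dots,2^{r+1}-1\}$,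 $r\ge0$. $A_0$ is drawn from an arbitrary fixed distribution. After block $B_r$ it draws a prefix length $M_r$ independently of everything else ($M_0=1$, and $M_r$ uniform on $\{2^{r-1}+1,\dots,2^r\}$ for $r\ge1$) and then $A_{r+1}=j$ with probability proportional to $\exp\bigl(-\eta\sum_{s=1}^{M_r}X_{2^r-1+s,\,j}\bigr)$. **Corollary (Matching rate).** The optimal gap-dependent regret rate is $\Theta\bigl(\frac{\log K}{\Delta_{\min}}+\frac{\log K}{\varepsilon}\bigr)$, in the following sense. 1. (Upper bound.) For all $K\ge2$ and $\varepsilon>0$ the randomized-prefix softmax algorithm, which knows neither $\Delta_{\min}$ nor the horizon, is $\varepsilon$-DP, and for every $\nu$ with a unique best action and every $T$, $$\operatorname{Reg}_T\le 1000\Bigl(\frac{\log K}{\Delta_{\min}}+\frac{\log K}{\varepsilon}\Bigr).$$ 2. (Lower bound.) For every $\delta\in(0,1)$ there is $c>0$, depending only on $\delta$, such that for all $K\ge2$, $\varepsilon>0$ and $\Delta\in(0,1]$ with $\Delta\le 1-\delta$ or $\varepsilon\le 1/\delta$, every $\varepsilon$-DP algorithm and every horizon $T$, there is a law $\nu$ on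 $[0,1]^K$, which may even be taken to be a product over the actions, with a unique best action and $\Delta_{\min}=\Delta$, for which $$\operatorname{Reg}_T\ge c\,\min\Bigl\{T\Delta,\ \frac{\log K}{\Delta}+\frac{\log K}{\varepsilon}\Bigr\}.$$ In particular $\operatorname{Reg}_T\ge c\bigl(\frac{\log K}{\Delta}+\frac{\log K}{\varepsilon}\bigr)$ as soon as $T\Delta\ge\frac{\log K}{\Delta}+\frac{\log K}{\varepsilon}$. -/

import Mathlib

open MeasureTheory

/-- A loss vector: one loss in `[0,1]` for each of the `K` actions. -/
abbrev LossVector (K : ℕ) : Type := Fin K → unitInterval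

/-- A randomized online algorithm with full information. In round `t + 1` it has seen the loss
vectors `x` and its own actions `h` of the first `t` rounds, and draws its next action from
`policy t x h`. Round `t + 1` is indexed by `t`, so that time starts at `0`. -/
structure OnlineAlgorithm (K : ℕ) where
  policy : (t : ℕ) → (Fin t → LossVector K) → (Fin t → Fin K) → PMF (Fin K)
  measurable_policy : ∀ (t : ℕ) (h : Fin t → Fin K) (b : Fin K),
    Measurable fun x : Fin t → LossVector K => policy t x h b

namespace OnlineAlgorithm

variable {K : ℕ}

/-- The law of the first `t` actions when the loss vectors are fixed to be `x`; the
randomness is that of the algorithm only. -/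
noncomputable def law (alg : OnlineAlgorithm K) :
    (t : ℕ) → (Fin t → LossVector K) → PMF (Fin t → Fin K)
  | 0, _ => PMF.pure Fin.elim0
  | t + 1, x =>
      (law alg t (fun i => x i.castSucc)).bind fun h =>
        (alg.policy t (fun i => x i.castSucc) h).map fun b =>
          (Fin.snoc h b : Fin (t + 1) → Fin K)

/-- Event-level pure `ε`-differential privacy. -/
def IsDP (alg : OnlineAlgorithm K) (ε : ℝ) : Prop :=
  ∀ (t : ℕ) (x x' : Fin t → LossVector K), {s | x s ≠ x' s}.Subsingleton →
    ∀ S : Set (Fin t → Fin K),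
      (alg.law t x).toMeasure S ≤ ENNReal.ofReal (Real.exp ε) * (alg.law t x').toMeasure S

/-- The expected pseudoregret up to horizon `T` against the action `best`, when the loss vectors
are independent with common law `ν`. -/
noncomputable def regret (alg : OnlineAlgorithm K) (ν : Measure (LossVector K)) (best : Fin K)
    (T : ℕ) : ℝ :=
  ∫ x : Fin T → LossVector K,
    (∫ a : Fin T → Fin K, ∑ t, ((x t (a t) : ℝ) - (x t best : ℝ)) ∂(alg.law T x).toMeasure)
    ∂(Measure.pi fun _ => ν)

end OnlineAlgorithm

/-- The expected loss of action `j`. -/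
noncomputable def meanLoss {K : ℕ} (ν : Measure (LossVector K)) (j : Fin K) : ℝ :=
  ∫ v, (v j : ℝ) ∂ν

/-- Under `ν`, the action `best` is the unique best action and `Δ` is the (positive) gap
between its expected loss and that of the second-best action. -/
def HasMinGap {K : ℕ} (ν : Measure (LossVector K)) (best : Fin K) (Δ : ℝ) : Prop :=
  0 < Δ ∧ IsLeast {d | ∃ j, j ≠ best ∧ d = meanLoss ν j - meanLoss ν best} Δ

section RandomizedPrefix

/-- The exponential-weights distribution: `j` has probability
`exp (-η * L j) / ∑ i, exp (-η * L i)`. -/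
noncomputable def softmaxPMF {K : ℕ} [NeZero K] (η : ℝ) (L : Fin K → ℝ) : PMF (Fin K) :=
  PMF.normalize (fun j => ENNReal.ofReal (Real.exp (-η * L j)))
    (by
      rw [ne_eq, ENNReal.tsum_eq_zero]
      intro h
      have h0 := h 0
      rw [ENNReal.ofReal_eq_zero] at h0
      exact absurd (Real.exp_pos _) (not_lt.mpr h0))
    (by
      rw [tsum_fintype]
      exact ENNReal.sum_ne_top.mpr fun _ _ => ENNReal.ofReal_ne_top)

/-- The law of the random prefix length in block `r`: uniform on `{2^(r-1)+1, …, 2^r}` if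
`r ≥ 1`, and equal to `1` if `r = 0` (where `2^0 / 2 = 0` in `ℕ`). -/
noncomputable def prefixLengthPMF (r : ℕ) : PMF ℕ :=
  PMF.uniformOfFinset (Finset.Ioc (2 ^ r / 2) (2 ^ r))
    (Finset.nonempty_Ioc.mpr (Nat.div_lt_self (by positivity) (by norm_num)))

/-- The cumulative loss of action `j` over the first `m` rounds `2^r, …, 2^r + m - 1` of
block `r`, the block of the rounds `2^r, …, 2^(r+1) - 1`. The entry `x i` is the loss vector of
round `i + 1`. -/
noncomputable def blockPrefixLoss {K t : ℕ} (x : Fin t → LossVector K) (r m : ℕ) (j : Fin K) :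
    ℝ :=
  ∑ i : Fin t, if 2 ^ r ≤ (i : ℕ) + 1 ∧ (i : ℕ) + 1 < 2 ^ r + m then (x i j : ℝ) else 0

/-- The rule of the randomized-prefix softmax algorithm with inverse temperature `η` and initial
distribution `p₀`. In round `1` the action is drawn from `p₀`. In round `t + 1 = 2^(r+1)`, the
first one of block `r + 1`, a prefix length is drawn and then an action by exponential weights on
that prefix of block `r`. In any other round the previous action is repeated. -/
noncomputable def randomizedPrefixPolicy {K : ℕ} [NeZero K] (η : ℝ) (p₀ : PMF (Fin K))
    (t : ℕ) (x : Fin t → LossVector K) (h : Fin t → Fin K) : PMF (Fin K) :=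
  if ht : t = 0 then p₀
  else if t + 1 = 2 ^ Nat.log 2 (t + 1) then
    (prefixLengthPMF (Nat.log 2 (t + 1) - 1)).bind fun m =>
      softmaxPMF η (blockPrefixLoss x (Nat.log 2 (t + 1) - 1) m)
  else PMF.pure (h ⟨t - 1, Nat.sub_lt (Nat.pos_of_ne_zero ht) Nat.one_pos⟩)

/-- The randomized-prefix softmax algorithm, with `η = min (ε / 2) (1 / 8)`. -/
noncomputable def randomizedPrefixSoftmax {K : ℕ} [NeZero K] (ε : ℝ) (p₀ : PMF (Fin K)) :
    OnlineAlgorithm K where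
  policy := randomizedPrefixPolicy (min (ε / 2) (1 / 8)) p₀
  measurable_policy := by
    intro t h b
    unfold randomizedPrefixPolicy
    split_ifs with ht hb
    · exact measurable_const
    · have hL : ∀ (r m : ℕ) (j : Fin K),
          Measurable fun x : Fin t → LossVector K => blockPrefixLoss x r m j := by
        intro r m j
        unfold blockPrefixLoss
        refine Finset.measurable_sum _ fun i _ => ?_
        split_ifs
        · fun_prop
        · exact measurable_const
      simp only [PMF.bind_apply, softmaxPMF, PMF.normalize_apply, tsum_fintype]
      refine Measurable.ennreal_tsum fun m => Measurable.const_mul ?_ _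
      have hw : ∀ j : Fin K, Measurable fun x : Fin t → LossVector K =>
          ENNReal.ofReal (Real.exp (-min (ε / 2) (1 / 8) *
            blockPrefixLoss x (Nat.log 2 (t + 1) - 1) m j)) := fun j =>
        ((Real.measurable_exp.comp ((hL _ m j).const_mul _))).ennreal_ofReal
      exact (hw b).mul (Finset.measurable_sum _ fun j _ => hw j).inv
    · exact measurable_const

end RandomizedPrefix

/-! The action of a round is chosen before its loss vector is revealed, so the regret is the sum
over rounds of the expected gap of the chosen action (`regret_eq_sum`). Both halves work only with
the marginal law `nextLaw`.

Upper bound. The action of block `r + 1` is drawn by exponential weights on a uniformly chosen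
prefix length from the upper half of block `r`. The losses are i.i.d., so its expected gap is the
average of `hedgeGap m` over these `m`. A block is at most four times as long as the number of
available prefix lengths, and each `m` serves exactly one block; the total regret is therefore at
most `1 + 4 ∑ hedgeGap m`. This is the regret of exponential weights with a constant learning rate
on one i.i.d. stream. To bound it, write each gap as twice its empirical estimate plus a deviation
(`hedgeGap_succ_le`). By exchangeability the estimate may be replaced by the loss of the last
sample, already included in the weights, and the be-the-leader inequality telescopes to `log K / η`.
The deviation of a suboptimal action has negative mean, minus its gap, so it is of order `√(log K /
m)` up to `m ≈ log K / Δ²` and decays exponentially afterwards; its sum is `O(log K / Δ)`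
(`sum_hedgeDeviation_le`).

Privacy. One loss vector is read by a single draw, the one opening the next block, and that draw is
an exponential mechanism of sensitivity one, which costs `2η ≤ ε`.

Lower bound. There are `K` instances, the `i`-th improving action `i` of a common base law. Under
the base law the probabilities of playing `i` add up to one. Passing to instance `i` multiplies them
by a controlled amount: by a second-moment (chi-square) bound on the likelihood ratio for `t ≲ log K
/ Δ²`, or by group privacy under a coupling that changes about `tΔ` loss vectors for `t ≲ log K /
(εΔ)`. So on average the best action is missed with constant probability, and some instance has
large regret (`exists_le_regret`). -/

/-! ### Product measures and i.i.d. families. -/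

section PiMeasures

variable {ι κ α : Type*} [Fintype ι] [Fintype κ] [MeasurableSpace α]

/-- Reading a random i.i.d. family along an injection again gives an i.i.d. family. -/
theorem measurePreserving_pi_comp_injective (ν : Measure α) [IsProbabilityMeasure ν]
    (e : ι → κ) (he : Function.Injective e) :
    MeasurePreserving (fun (x : κ → α) (i : ι) => x (e i))
      (Measure.pi fun _ => ν) (Measure.pi fun _ => ν) := by
  classical
  have hm : Measurable fun (x : κ → α) (i : ι) => x (e i) := by fun_prop
  refine ⟨hm, (Measure.pi_eq fun s hs => ?_).symm⟩
  rw [Measure.map_apply hm (MeasurableSet.univ_pi hs)]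
  -- The rectangle over `ι` pulls back to a rectangle over `κ` whose sides outside the range of `e`
  -- are the whole space, of mass one.
  let s' : κ → Set α := fun k => if h : ∃ i, e i = k then s h.choose else Set.univ
  have hs' : ∀ i, s' (e i) = s i := by
    intro i
    have h : ∃ i', e i' = e i := ⟨i, rfl⟩
    have : h.choose = i := he h.choose_spec
    simp only [s', dif_pos h, this]
  have hs'' : ∀ k, k ∉ Finset.univ.image e → s' k = Set.univ := by
    intro k hk
    have : ¬ ∃ i, e i = k := by simpa using hk
    simp only [s', dif_neg this]
  have hpre : (fun (x : κ → α) (i : ι) => x (e i)) ⁻¹' (Set.univ.pi s) = Set.univ.pi s' := by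
    ext x
    simp only [Set.mem_preimage, Set.mem_univ_pi]
    constructor
    · intro h k
      by_cases hk : k ∈ Finset.univ.image e
      · obtain ⟨i, -, rfl⟩ := Finset.mem_image.1 hk
        rw [hs']; exact h i
      · rw [hs'' k hk]; trivial
    · intro h i
      rw [← hs']; exact h (e i)
  rw [hpre, Measure.pi_pi, ← Finset.prod_subset (Finset.subset_univ (Finset.univ.image e)),
    Finset.prod_image (fun a _ b _ h => he h)]
  · simp only [hs']
  · intro k _ hk
    rw [hs'' k hk, measure_univ]

/-- Serves for dropping the last round, for exchangeability (a transposition), and for locating a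
prefix inside a block. -/
theorem integral_pi_comp_injective (ν : Measure α) [IsProbabilityMeasure ν]
    (e : ι → κ) (he : Function.Injective e) {f : (ι → α) → ℝ} (hf : Measurable f) :
    ∫ x : κ → α, f (fun i => x (e i)) ∂(Measure.pi fun _ => ν)
      = ∫ x, f x ∂(Measure.pi fun _ => ν) := by
  have h := measurePreserving_pi_comp_injective ν e he
  rw [← h.map_eq, integral_map h.measurable.aemeasurable hf.aestronglyMeasurable]

/-- A product of measures with densities has the product density. -/
theorem pi_withDensity_ofReal {β : ι → Type*} [∀ i, MeasurableSpace (β i)]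
    (μ : ∀ i, Measure (β i)) [∀ i, IsProbabilityMeasure (μ i)] (f : ∀ i, β i → ℝ)
    (hf : ∀ i, Integrable (f i) (μ i)) (h0 : ∀ i x, 0 ≤ f i x)
    [∀ i, SigmaFinite ((μ i).withDensity fun x => ENNReal.ofReal (f i x))] :
    Measure.pi (fun i => (μ i).withDensity fun x => ENNReal.ofReal (f i x)) =
      (Measure.pi μ).withDensity fun x => ENNReal.ofReal (∏ i, f i (x i)) := by
  refine Measure.pi_eq fun s hs => ?_
  have hind : ∀ i, Integrable ((s i).indicator (f i)) (μ i) := fun i => (hf i).indicator (hs i)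
  rw [withDensity_apply _ (MeasurableSet.univ_pi hs), ← lintegral_indicator
    (MeasurableSet.univ_pi hs)]
  have h1 : ∀ x : (∀ i, β i), (Set.univ.pi s).indicator
      (fun x => ENNReal.ofReal (∏ i, f i (x i))) x
      = ENNReal.ofReal (∏ i, (s i).indicator (f i) (x i)) := by
    intro x
    by_cases hx : x ∈ Set.univ.pi s
    · rw [Set.indicator_of_mem hx]
      congr 1
      refine Finset.prod_congr rfl fun i _ => ?_
      rw [Set.indicator_of_mem (hx i trivial)]
    · rw [Set.indicator_of_notMem hx]
      simp only [Set.mem_univ_pi, not_forall] at hx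
      obtain ⟨i, hi⟩ := hx
      rw [Finset.prod_eq_zero (Finset.mem_univ i), ENNReal.ofReal_zero]
      exact Set.indicator_of_notMem hi _
  have hnn : ∀ i x, 0 ≤ (s i).indicator (f i) x := fun i x =>
    Set.indicator_nonneg (fun y _ => h0 i y) x
  simp_rw [h1]
  rw [← ofReal_integral_eq_lintegral_ofReal (Integrable.fintype_prod_dep hind)
    (Filter.Eventually.of_forall fun x => Finset.prod_nonneg fun i _ => hnn i _),
    integral_fintype_prod_eq_prod, ENNReal.ofReal_prod_of_nonneg
      (fun i _ => integral_nonneg (hnn i))]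
  refine Finset.prod_congr rfl fun i _ => ?_
  rw [withDensity_apply _ (hs i), ← lintegral_indicator (hs i),
    ofReal_integral_eq_lintegral_ofReal (hind i) (Filter.Eventually.of_forall (hnn i))]
  refine lintegral_congr fun x => ?_
  by_cases hx : x ∈ s i
  · simp [hx]
  · simp [hx]

/-- Bounded measurable functions are integrable for finite measures. -/
theorem integrable_of_measurable_of_abs_le {μ : Measure α} [IsFiniteMeasure μ] {f : α → ℝ}
    (hf : Measurable f) (C : ℝ) (h : ∀ x, |f x| ≤ C) : Integrable f μ :=
  Integrable.of_bound hf.aestronglyMeasurable C (Filter.Eventually.of_forall h)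

/-- For an i.i.d. family of `n + 1` variables, the last one is independent of the others. -/
theorem integral_pi_init_mul_last (ν : Measure α) [IsProbabilityMeasure ν] (n : ℕ)
    (f : (Fin n → α) → ℝ) (g : α → ℝ) :
    ∫ x : Fin (n + 1) → α, f (fun i => x i.castSucc) * g (x (Fin.last n))
        ∂(Measure.pi fun _ => ν)
      = (∫ x, f x ∂(Measure.pi fun _ => ν)) * ∫ v, g v ∂ν := by
  have h := (measurePreserving_piFinSuccAbove (fun _ : Fin (n + 1) => ν) (Fin.last n))
  have h2 := h.integral_comp' (fun z : α × (Fin n → α) => g z.1 * f z.2)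
  rw [integral_prod_mul] at h2
  rw [mul_comm, ← h2]
  refine integral_congr_ae (Filter.Eventually.of_forall fun x => ?_)
  simp only [MeasurableEquiv.piFinSuccAbove_apply, Fin.insertNthEquiv_symm_apply]
  rw [mul_comm]
  congr 2
  funext i
  simp [Fin.removeNth]

end PiMeasures

/-! ### Marginal laws of the actions and the regret. -/

theorem PMF.sum_toReal {α : Type*} [Fintype α] (p : PMF α) : ∑ a, (p a).toReal = 1 := by
  rw [← ENNReal.toReal_sum (fun a _ => p.apply_ne_top a)]
  have := p.tsum_coe
  rw [tsum_fintype] at this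
  rw [this, ENNReal.toReal_one]

theorem PMF.toReal_apply_le_one {α : Type*} (p : PMF α) (a : α) : (p a).toReal ≤ 1 := by
  have := ENNReal.toReal_mono ENNReal.one_ne_top (p.coe_le_one a)
  simpa using this

namespace OnlineAlgorithm

variable {K : ℕ}

/-- The law of the next action when the loss vectors of the first `t` rounds are `x`. -/
noncomputable def nextLaw (alg : OnlineAlgorithm K) (t : ℕ) (x : Fin t → LossVector K) :
    PMF (Fin K) :=
  (alg.law t x).bind (alg.policy t x)

theorem law_succ_snoc (alg : OnlineAlgorithm K) (t : ℕ) (x : Fin (t + 1) → LossVector K)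
    (h : Fin t → Fin K) (b : Fin K) :
    alg.law (t + 1) x (Fin.snoc h b : Fin (t + 1) → Fin K) =
      alg.law t (fun i => x i.castSucc) h * alg.policy t (fun i => x i.castSucc) h b := by
  rw [law, PMF.bind_apply, tsum_fintype, Finset.sum_eq_single h]
  · congr 1
    rw [PMF.map_apply, tsum_fintype, Finset.sum_eq_single b]
    · simp
    · intro b' _ hb'
      rw [if_neg]
      intro he
      exact hb' (Fin.snoc_injective2 he).2.symm
    · simp
  · intro h' _ hh'
    rw [PMF.map_apply, tsum_fintype, Finset.sum_eq_zero, mul_zero]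
    intro b' _
    rw [if_neg]
    intro he
    exact hh' (Fin.snoc_injective2 he).1.symm
  · simp

theorem measurable_law (alg : OnlineAlgorithm K) (t : ℕ) (a : Fin t → Fin K) :
    Measurable fun x => alg.law t x a := by
  induction t with
  | zero => simp only [law]; exact measurable_const
  | succ t ih =>
    obtain ⟨⟨b, h⟩, rfl⟩ := (Fin.snocEquiv fun _ : Fin (t + 1) => Fin K).surjective a
    have he : (Fin.snocEquiv fun _ : Fin (t + 1) => Fin K) (b, h) = Fin.snoc h b := rfl
    simp only [he, law_succ_snoc]
    have hm : Measurable fun (x : Fin (t + 1) → LossVector K) (i : Fin t) => x i.castSucc := by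
      fun_prop
    exact ((ih h).comp hm).mul ((alg.measurable_policy t h b).comp hm)

theorem nextLaw_apply (alg : OnlineAlgorithm K) (t : ℕ) (x : Fin t → LossVector K) (b : Fin K) :
    alg.nextLaw t x b = ∑ h, alg.law t x h * alg.policy t x h b := by
  rw [nextLaw, PMF.bind_apply, tsum_fintype]

theorem measurable_nextLaw (alg : OnlineAlgorithm K) (t : ℕ) (b : Fin K) :
    Measurable fun x => (alg.nextLaw t x b).toReal := by
  simp only [nextLaw_apply]
  exact (Finset.measurable_sum _ fun h _ =>
    (alg.measurable_law t h).mul (alg.measurable_policy t h b)).ennreal_toReal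

theorem nextLaw_toReal_apply (alg : OnlineAlgorithm K) (t : ℕ) (x : Fin t → LossVector K)
    (b : Fin K) :
    (alg.nextLaw t x b).toReal =
      ∑ h, (alg.law t x h).toReal * (alg.policy t x h b).toReal := by
  rw [nextLaw_apply, ENNReal.toReal_sum]
  · simp only [ENNReal.toReal_mul]
  · intro h _
    exact ENNReal.mul_ne_top ((alg.law t x).apply_ne_top h) ((alg.policy t x h).apply_ne_top b)

theorem integrable_nextLaw (alg : OnlineAlgorithm K) (t : ℕ) (b : Fin K)
    (μ : Measure (Fin t → LossVector K)) [IsFiniteMeasure μ] :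
    Integrable (fun x => (alg.nextLaw t x b).toReal) μ :=
  integrable_of_measurable_of_abs_le (alg.measurable_nextLaw t b) 1 fun x => by
    rw [abs_of_nonneg ENNReal.toReal_nonneg]
    exact PMF.toReal_apply_le_one _ _

/-- The regret is determined by the marginal laws of the actions. -/
theorem regret_eq_sum (alg : OnlineAlgorithm K) (ν : Measure (LossVector K))
    [IsProbabilityMeasure ν] (best : Fin K) (T : ℕ) :
    alg.regret ν best T = ∑ t ∈ Finset.range T, ∑ b, (meanLoss ν b - meanLoss ν best) *
      ∫ x, (alg.nextLaw t x b).toReal ∂(Measure.pi fun _ => ν) := by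
  have hreg : ∀ T, alg.regret ν best T = ∫ x : Fin T → LossVector K,
      (∑ a, (alg.law T x a).toReal * ∑ t, ((x t (a t) : ℝ) - (x t best : ℝ)))
        ∂(Measure.pi fun _ => ν) := by
    intro T
    simp only [regret, PMF.integral_eq_sum, smul_eq_mul]
  have hmeas : ∀ T, Measurable fun x : Fin T → LossVector K =>
      ∑ a, (alg.law T x a).toReal * ∑ t, ((x t (a t) : ℝ) - (x t best : ℝ)) := by
    intro T
    refine Finset.measurable_sum _ fun a _ => ((alg.measurable_law T a).ennreal_toReal).mul ?_
    fun_prop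
  have hbd : ∀ (T : ℕ) (x : Fin T → LossVector K),
      |∑ a, (alg.law T x a).toReal * ∑ t, ((x t (a t) : ℝ) - (x t best : ℝ))| ≤ T := by
    intro T x
    calc _ ≤ ∑ a, |(alg.law T x a).toReal * ∑ t, ((x t (a t) : ℝ) - (x t best : ℝ))| :=
          Finset.abs_sum_le_sum_abs _ _
      _ ≤ ∑ a, (alg.law T x a).toReal * T := by
          refine Finset.sum_le_sum fun a _ => ?_
          rw [abs_mul, abs_of_nonneg ENNReal.toReal_nonneg]
          refine mul_le_mul_of_nonneg_left ?_ ENNReal.toReal_nonneg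
          calc _ ≤ ∑ t, |(x t (a t) : ℝ) - (x t best : ℝ)| := Finset.abs_sum_le_sum_abs _ _
            _ ≤ ∑ t : Fin T, (1 : ℝ) := Finset.sum_le_sum fun t _ => by
                rw [abs_le]
                constructor <;> linarith [(x t (a t)).2.1, (x t (a t)).2.2, (x t best).2.1,
                  (x t best).2.2]
            _ = T := by simp
      _ = T := by rw [← Finset.sum_mul, PMF.sum_toReal, one_mul]
  induction T with
  | zero => rw [hreg]; simp
  | succ T ih =>
    rw [Finset.sum_range_succ, ← ih, hreg, hreg]
    have hinit := measurePreserving_pi_comp_injective ν (Fin.castSucc : Fin T → Fin (T + 1))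
      (Fin.castSucc_injective T)
    -- Summing out the last action leaves the earlier rounds unchanged. The last round depends on
    -- the past only through `nextLaw`, which is independent of the last loss vector.
    have hstep : ∀ x : Fin (T + 1) → LossVector K,
        (∑ a, (alg.law (T + 1) x a).toReal * ∑ t, ((x t (a t) : ℝ) - (x t best : ℝ)))
        = (∑ a, (alg.law T (fun i => x i.castSucc) a).toReal *
              ∑ t, ((x (Fin.castSucc t) (a t) : ℝ) - (x (Fin.castSucc t) best : ℝ)))
          + ∑ b, (alg.nextLaw T (fun i => x i.castSucc) b).toReal *
              ((x (Fin.last T) b : ℝ) - (x (Fin.last T) best : ℝ)) := by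
      intro x
      rw [← (Fin.snocEquiv fun _ : Fin (T + 1) => Fin K).sum_comp, Fintype.sum_prod_type_right]
      have he : ∀ (h : Fin T → Fin K) b,
        (Fin.snocEquiv fun _ : Fin (T + 1) => Fin K) (b, h) = Fin.snoc h b := fun _ _ => rfl
      simp only [he, law_succ_snoc, Fin.sum_univ_castSucc, Fin.snoc_castSucc, Fin.snoc_last,
        ENNReal.toReal_mul, mul_add, Finset.sum_add_distrib]
      congr 1
      · refine Finset.sum_congr rfl fun h _ => ?_
        rw [← Finset.sum_mul, ← Finset.mul_sum, PMF.sum_toReal, mul_one]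
      · rw [Finset.sum_comm]
        refine Finset.sum_congr rfl fun b _ => ?_
        rw [nextLaw_toReal_apply, Finset.sum_mul]
    simp_rw [hstep]
    have hI : ∀ b, Integrable (fun x : Fin (T + 1) → LossVector K =>
        (alg.nextLaw T (fun i => x i.castSucc) b).toReal *
          ((x (Fin.last T) b : ℝ) - (x (Fin.last T) best : ℝ))) (Measure.pi fun _ => ν) := by
      intro b
      refine integrable_of_measurable_of_abs_le ?_ 1 fun x => ?_
      · refine ((alg.measurable_nextLaw T b).comp hinit.measurable).mul ?_
        fun_prop
      · rw [abs_mul, abs_of_nonneg ENNReal.toReal_nonneg]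
        refine mul_le_one₀ (PMF.toReal_apply_le_one _ _) (abs_nonneg _) ?_
        rw [abs_le]
        constructor <;> linarith [(x (Fin.last T) b).2.1, (x (Fin.last T) b).2.2,
          (x (Fin.last T) best).2.1, (x (Fin.last T) best).2.2]
    have hI1 : Integrable (fun x : Fin T → LossVector K =>
        ∑ a, (alg.law T x a).toReal * ∑ t, ((x t (a t) : ℝ) - (x t best : ℝ)))
        (Measure.pi fun _ => ν) := integrable_of_measurable_of_abs_le (hmeas T) T (hbd T)
    have hI2 := hinit.integrable_comp_of_integrable hI1
    simp only [Function.comp_def] at hI2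
    rw [integral_add hI2 (integrable_finsetSum _ fun b _ => hI b),
      integral_finsetSum _ fun b _ => hI b]
    congr 1
    · exact integral_pi_comp_injective ν _ (Fin.castSucc_injective T) (hmeas T)
    · refine Finset.sum_congr rfl fun b _ => ?_
      rw [integral_pi_init_mul_last ν T (fun x => (alg.nextLaw T x b).toReal)
        (fun v => (v b : ℝ) - (v best : ℝ)), integral_sub, mul_comm]
      · rfl
      · exact integrable_of_measurable_of_abs_le (by fun_prop) 1 fun v => by
          rw [abs_of_nonneg (v b).2.1]; exact (v b).2.2
      · exact integrable_of_measurable_of_abs_le (by fun_prop) 1 fun v => by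
          rw [abs_of_nonneg (v best).2.1]; exact (v best).2.2

end OnlineAlgorithm

/-! ### Averaging over instances, and group privacy. -/

namespace OnlineAlgorithm

variable {K : ℕ}

theorem sum_integral_nextLaw (alg : OnlineAlgorithm K) (t : ℕ)
    (μ : Measure (Fin t → LossVector K)) [IsProbabilityMeasure μ] :
    ∑ b, ∫ x, (alg.nextLaw t x b).toReal ∂μ = 1 := by
  rw [← integral_finsetSum _ fun b _ => alg.integrable_nextLaw t b μ]
  simp [PMF.sum_toReal]

theorem integral_nextLaw_le_one (alg : OnlineAlgorithm K) (t : ℕ) (b : Fin K)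
    (μ : Measure (Fin t → LossVector K)) [IsProbabilityMeasure μ] :
    ∫ x, (alg.nextLaw t x b).toReal ∂μ ≤ 1 := by
  rw [← alg.sum_integral_nextLaw t μ]
  exact Finset.single_le_sum (f := fun b => ∫ x, (alg.nextLaw t x b).toReal ∂μ)
    (fun b _ => integral_nonneg fun x => ENNReal.toReal_nonneg) (Finset.mem_univ b)

/-- Every action other than `best` costs at least `Δ` in expectation. -/
theorem le_regret_of_hasMinGap (alg : OnlineAlgorithm K) (ν : Measure (LossVector K))
    [IsProbabilityMeasure ν] {best : Fin K} {Δ : ℝ} (h : HasMinGap ν best Δ) (T : ℕ) :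
    ∑ t ∈ Finset.range T,
      Δ * (1 - ∫ x, (alg.nextLaw t x best).toReal ∂(Measure.pi fun _ => ν))
        ≤ alg.regret ν best T := by
  rw [regret_eq_sum]
  refine Finset.sum_le_sum fun t _ => ?_
  rw [← alg.sum_integral_nextLaw t (Measure.pi fun _ => ν),
    ← Finset.sum_erase_eq_sub (Finset.mem_univ best), Finset.mul_sum,
    ← Finset.add_sum_erase _ _ (Finset.mem_univ best), sub_self, zero_mul, zero_add]
  refine Finset.sum_le_sum fun b hb => ?_
  refine mul_le_mul_of_nonneg_right ?_ (integral_nonneg fun x => ENNReal.toReal_nonneg)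
  exact h.2.2 ⟨b, Finset.ne_of_mem_erase hb, rfl⟩

/-- If the best action is rarely found on average over a family of instances up to time `u`, then
the regret is large on one of the instances. -/
theorem exists_le_regret (alg : OnlineAlgorithm K) (hK : 2 ≤ K)
    (ν : Fin K → Measure (LossVector K)) [∀ i, IsProbabilityMeasure (ν i)] {Δ : ℝ}
    (hgap : ∀ i, HasMinGap (ν i) i Δ) (u c : ℝ) (hu : 0 ≤ u) (hc : 0 ≤ c)
    (h : ∀ t : ℕ, (t : ℝ) ≤ u →
      ∑ i, ∫ x, (alg.nextLaw t x i).toReal ∂(Measure.pi fun _ => ν i) ≤ (1 - c) * K) (T : ℕ) :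
    ∃ i, c * (Δ * min (T : ℝ) u) ≤ alg.regret (ν i) i T := by
  have hΔ : 0 < Δ := (hgap ⟨0, by omega⟩).1
  have hne : (Finset.univ : Finset (Fin K)).Nonempty := ⟨⟨0, by omega⟩, Finset.mem_univ _⟩
  by_contra! hcon
  have h1 := Finset.sum_lt_sum_of_nonempty hne fun i _ => hcon i
  have h2 : ∑ i, ∑ t ∈ Finset.range T,
      Δ * (1 - ∫ x, (alg.nextLaw t x i).toReal ∂(Measure.pi fun _ => ν i))
      ≤ ∑ i, alg.regret (ν i) i T :=
    Finset.sum_le_sum fun i _ => alg.le_regret_of_hasMinGap (ν i) (hgap i) T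
  rw [Finset.sum_comm] at h2
  -- Time starts at `0`, so the rounds with `t ≤ u` number `⌊u⌋ + 1`, which is at least `u`.
  set N := min T (⌊u⌋₊ + 1) with hN
  have h3 : ∑ t ∈ Finset.range N, ∑ i,
      Δ * (1 - ∫ x, (alg.nextLaw t x i).toReal ∂(Measure.pi fun _ => ν i))
      ≤ ∑ t ∈ Finset.range T, ∑ i,
      Δ * (1 - ∫ x, (alg.nextLaw t x i).toReal ∂(Measure.pi fun _ => ν i)) := by
    refine Finset.sum_le_sum_of_subset_of_nonneg
      (Finset.range_subset_range.2 (min_le_left _ _)) fun t _ _ => ?_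
    refine Finset.sum_nonneg fun i _ => mul_nonneg hΔ.le ?_
    linarith [alg.integral_nextLaw_le_one t i (Measure.pi fun _ => ν i)]
  have h4 : ∑ t ∈ Finset.range N, Δ * (c * K) ≤ ∑ t ∈ Finset.range N, ∑ i,
      Δ * (1 - ∫ x, (alg.nextLaw t x i).toReal ∂(Measure.pi fun _ => ν i)) := by
    refine Finset.sum_le_sum fun t ht => ?_
    rw [← Finset.mul_sum, Finset.sum_sub_distrib]
    refine mul_le_mul_of_nonneg_left ?_ hΔ.le
    have htu : (t : ℝ) ≤ u := by
      rw [← Nat.le_floor_iff hu]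
      have := Finset.mem_range.1 ht
      omega
    have := h t htu
    simp only [Finset.sum_const, Finset.card_univ, Fintype.card_fin, nsmul_eq_mul, mul_one]
    linarith
  have h5 : min (T : ℝ) u ≤ N := by
    rw [hN]; push_cast
    exact min_le_min le_rfl (Nat.lt_floor_add_one u).le
  simp only [Finset.sum_const, Finset.card_univ, Fintype.card_fin, Finset.card_range,
    nsmul_eq_mul] at h1 h4
  have h6 : (K : ℝ) * (c * (Δ * min (T : ℝ) u)) ≤ N * (Δ * (c * K)) := by
    have := mul_le_mul_of_nonneg_right h5 (show 0 ≤ Δ * (c * K) by positivity)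
    linarith
  linarith

/-- Turns a statement about the next action into an event on histories, the form in which privacy is
defined; the last loss vector plays no role. -/
theorem toMeasure_last_eq_nextLaw (alg : OnlineAlgorithm K) (t : ℕ)
    (x : Fin (t + 1) → LossVector K) (b : Fin K) :
    (alg.law (t + 1) x).toMeasure {a | a (Fin.last t) = b} =
      alg.nextLaw t (fun i => x i.castSucc) b := by
  rw [PMF.toMeasure_apply_fintype, ← (Fin.snocEquiv fun _ : Fin (t + 1) => Fin K).sum_comp,
    Fintype.sum_prod_type, Finset.sum_eq_single b]
  · rw [nextLaw_apply]
    refine Finset.sum_congr rfl fun h _ => ?_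
    have he : (Fin.snocEquiv fun _ : Fin (t + 1) => Fin K) (b, h) = Fin.snoc h b := rfl
    rw [he, Set.indicator_of_mem, law_succ_snoc]
    simp
  · intro b' _ hb'
    refine Finset.sum_eq_zero fun h _ => ?_
    have he : (Fin.snocEquiv fun _ : Fin (t + 1) => Fin K) (b', h) = Fin.snoc h b' := rfl
    rw [he, Set.indicator_of_notMem]
    simpa using hb'
  · simp

theorem IsDP.nextLaw_le {alg : OnlineAlgorithm K} {ε : ℝ} (h : alg.IsDP ε) {t : ℕ}
    (x x' : Fin t → LossVector K) (hx : {s | x s ≠ x' s}.Subsingleton) (b : Fin K) :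
    (alg.nextLaw t x b).toReal ≤ Real.exp ε * (alg.nextLaw t x' b).toReal := by
  -- The same dummy vector is appended to both sequences, so they still differ in at most one place.
  let y : Fin (t + 1) → LossVector K := Fin.snoc x fun _ => 0
  let y' : Fin (t + 1) → LossVector K := Fin.snoc x' fun _ => 0
  have hy : {s | y s ≠ y' s}.Subsingleton := by
    intro s hs s' hs'
    induction s using Fin.lastCases with
    | last => simp [y, y'] at hs
    | cast s =>
      induction s' using Fin.lastCases with
      | last => simp [y, y'] at hs'
      | cast s' =>
        simp only [y, y', Set.mem_ofPred_eq, Fin.snoc_castSucc] at hs hs'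
        rw [hx hs hs']
  have := h (t + 1) y y' hy {a | a (Fin.last t) = b}
  rw [toMeasure_last_eq_nextLaw, toMeasure_last_eq_nextLaw] at this
  simp only [y, y', Fin.snoc_castSucc] at this
  have h2 := ENNReal.toReal_mono
    (ENNReal.mul_ne_top ENNReal.ofReal_ne_top ((alg.nextLaw t x').apply_ne_top b)) this
  rwa [ENNReal.toReal_mul, ENNReal.toReal_ofReal (Real.exp_pos _).le] at h2

/-- Group privacy for the next action. -/
theorem IsDP.nextLaw_le_card {alg : OnlineAlgorithm K} {ε : ℝ} (h : alg.IsDP ε) {t : ℕ}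
    (x' : Fin t → LossVector K) (b : Fin K) (D : Finset (Fin t)) :
    ∀ x : Fin t → LossVector K, (∀ s, s ∉ D → x s = x' s) →
    (alg.nextLaw t x b).toReal ≤ Real.exp (ε * D.card) * (alg.nextLaw t x' b).toReal := by
  induction D using Finset.induction_on with
  | empty =>
    intro x hx
    rw [show x = x' from funext fun s => hx s (Finset.notMem_empty s)]
    simp
  | insert a D ha ih =>
    intro x hx
    have h1 := ih (Function.update x a (x' a)) fun s hs => by
      by_cases hsa : s = a
      · subst hsa; simp
      · rw [Function.update_of_ne hsa]
        exact hx s (by simp [hsa, hs])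
    have h2 := h.nextLaw_le x (Function.update x a (x' a)) (by
      have : ∀ s ∈ {s | x s ≠ Function.update x a (x' a) s}, s = a := by
        intro s hs
        by_contra hsa
        exact hs (Function.update_of_ne hsa _ _).symm
      intro s hs s' hs'
      rw [this s hs, this s' hs']) b
    refine h2.trans ?_
    rw [Finset.card_insert_of_notMem ha, show ε * ((D.card + 1 : ℕ) : ℝ) = ε + ε * D.card by
      push_cast; ring, Real.exp_add, mul_assoc]
    exact mul_le_mul_of_nonneg_left h1 (Real.exp_pos _).le

end OnlineAlgorithm

/-! ### Building blocks of the hard instances. -/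

section Instances

/-- The Bernoulli law with mean `q` on the unit interval. -/
noncomputable def bernoulliLoss (q : ℝ) : Measure unitInterval :=
  ENNReal.ofReal q • Measure.dirac 1 + ENNReal.ofReal (1 - q) • Measure.dirac 0

theorem isProbabilityMeasure_bernoulliLoss {q : ℝ} (h0 : 0 ≤ q) (h1 : q ≤ 1) :
    IsProbabilityMeasure (bernoulliLoss q) := by
  refine ⟨?_⟩
  simp only [bernoulliLoss, Measure.add_apply, Measure.smul_apply, measure_univ, smul_eq_mul,
    mul_one]
  rw [← ENNReal.ofReal_add h0 (by linarith)]
  simp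

theorem integral_bernoulliLoss {q : ℝ} (h0 : 0 ≤ q) (h1 : q ≤ 1) (f : unitInterval → ℝ) :
    ∫ v, f v ∂(bernoulliLoss q) = q * f 1 + (1 - q) * f 0 := by
  have hd : ∀ a : unitInterval, Integrable f (Measure.dirac a) := fun a =>
    integrable_dirac (by finiteness)
  rw [bernoulliLoss, integral_add_measure ((hd 1).smul_measure ENNReal.ofReal_ne_top)
    ((hd 0).smul_measure ENNReal.ofReal_ne_top)]
  simp [integral_smul_measure, integral_dirac, ENNReal.toReal_ofReal h0,
    ENNReal.toReal_ofReal (sub_nonneg.2 h1)]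

theorem meanLoss_pi {K : ℕ} (p : Fin K → Measure unitInterval) [∀ j, IsProbabilityMeasure (p j)]
    (j : Fin K) : meanLoss (Measure.pi p) j = ∫ v, (v : ℝ) ∂(p j) := by
  have h := measurePreserving_eval p j
  rw [← h.map_eq, integral_map h.measurable.aemeasurable (by fun_prop)]
  rfl

theorem hasMinGap_pi {K : ℕ} (hK : 2 ≤ K) (p : Fin K → Measure unitInterval)
    [∀ j, IsProbabilityMeasure (p j)] (i : Fin K) {m Δ : ℝ} (hΔ : 0 < Δ)
    (hi : ∫ v, (v : ℝ) ∂(p i) = m - Δ) (hj : ∀ j, j ≠ i → ∫ v, (v : ℝ) ∂(p j) = m) :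
    HasMinGap (Measure.pi p) i Δ := by
  have hgap : ∀ j, j ≠ i → meanLoss (Measure.pi p) j - meanLoss (Measure.pi p) i = Δ := by
    intro j h
    rw [meanLoss_pi, meanLoss_pi, hi, hj j h]
    ring
  have : Nontrivial (Fin K) := Fin.nontrivial_iff_two_le.2 hK
  obtain ⟨j, hji⟩ := exists_ne i
  refine ⟨hΔ, ⟨j, hji, (hgap j hji).symm⟩, ?_⟩
  rintro d ⟨j, h, rfl⟩
  rw [hgap j h]

theorem integral_withDensity_ofReal {α : Type*} [MeasurableSpace α] (μ : Measure α)
    {f : α → ℝ} (hf : Measurable f) (h0 : ∀ x, 0 ≤ f x) (g : α → ℝ) :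
    ∫ x, g x ∂(μ.withDensity fun x => ENNReal.ofReal (f x)) = ∫ x, f x * g x ∂μ := by
  rw [integral_withDensity_eq_integral_toReal_smul hf.ennreal_ofReal
    (Filter.Eventually.of_forall fun x => ENNReal.ofReal_lt_top)]
  simp only [ENNReal.toReal_ofReal (h0 _), smul_eq_mul]

end Instances

/-! ### The statistical and the privacy lower bound. -/

section LowerBounds

variable {K : ℕ}

/-- With `r = K ^ (1/4)`, the averaged bounds below gain a power of `r` over the trivial bound `K =
r ^ 4`. This makes the gain a constant factor already at `K = 2`, as `1 + log 2 / 4 > 1.17`. -/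
theorem le_exp_log_div_four {K : ℕ} (hK : 2 ≤ K) : 1.17 ≤ Real.exp (Real.log K / 4) := by
  have h2 : Real.log 2 ≤ Real.log K := Real.log_le_log (by norm_num) (by exact_mod_cast hK)
  have := Real.add_one_le_exp (Real.log K / 4)
  linarith [Real.log_two_gt_d9]

theorem exp_log_div_four_pow {K : ℕ} (hK : 2 ≤ K) : Real.exp (Real.log K / 4) ^ 4 = K := by
  rw [← Real.exp_nat_mul, show ((4 : ℕ) : ℝ) * (Real.log K / 4) = Real.log K by push_cast; ring,
    Real.exp_log (by positivity)]

/-- The statistical part of the lower bound. -/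
theorem exists_le_regret_of_gap_lt_one (alg : OnlineAlgorithm K) (hK : 2 ≤ K) {δ Δ : ℝ}
    (hδ : 0 < δ) (hΔ : 0 < Δ) (hΔδ : Δ ≤ 1 - δ) (T : ℕ) :
    ∃ (p : Fin K → Measure unitInterval) (best : Fin K),
      (∀ j, IsProbabilityMeasure (p j)) ∧ HasMinGap (Measure.pi p) best Δ ∧
      1 / 10 * (Δ * min (T : ℝ) (δ * Real.log K / (8 * Δ ^ 2)))
        ≤ alg.regret (Measure.pi p) best T := by
  -- The two means `q` and `q - Δ` are placed symmetrically about `1/2`, so `4 q (1 - q) = 1 - Δ² ≥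
  -- δ`.
  obtain ⟨q, hq⟩ : ∃ q : ℝ, q = (1 + Δ) / 2 := ⟨_, rfl⟩
  have hq0 : 0 ≤ q := by rw [hq]; linarith
  have hq1 : q ≤ 1 := by rw [hq]; linarith
  have hqq : 0 < q * (1 - q) := by rw [hq]; nlinarith
  have hqΔ : Δ / (q * (1 - q)) * (1 - q) ≤ 1 := by
    have h1 : 0 < 1 - q := by rw [hq]; linarith
    have h2 : 0 < q := by rw [hq]; linarith
    rw [show Δ / (q * (1 - q)) * (1 - q) = Δ / q by field_simp, div_le_one h2, hq]
    linarith
  obtain ⟨χ, hχ⟩ : ∃ χ : ℝ, χ = Δ ^ 2 / (q * (1 - q)) := ⟨_, rfl⟩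
  have hχ0 : 0 < χ := by rw [hχ]; positivity
  have hχle : χ ≤ 4 * Δ ^ 2 / δ := by
    rw [hχ, div_le_div_iff₀ hqq hδ]
    have : δ ≤ 4 * (q * (1 - q)) := by rw [hq]; nlinarith
    nlinarith [sq_nonneg Δ]
  -- The density of Bernoulli(`q - Δ`) with respect to Bernoulli(`q`), extended affinely to the
  -- interval to make it continuous. Its chi-square divergence is `χ`.
  let f : unitInterval → ℝ := fun v => 1 - Δ / (q * (1 - q)) * (v - q)
  have hfc : Continuous f := by fun_prop
  have hf0 : ∀ v, 0 ≤ f v := by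
    intro v
    have h1 : (v : ℝ) - q ≤ 1 - q := by linarith [v.2.2]
    have := mul_le_mul_of_nonneg_left h1 (div_pos hΔ hqq).le
    simp only [f]; linarith
  let B := bernoulliLoss q
  have hB : IsProbabilityMeasure B := isProbabilityMeasure_bernoulliLoss hq0 hq1
  let g : Fin K → Fin K → unitInterval → ℝ := fun i j v => if j = i then f v else 1
  have hgc : ∀ i j, Continuous (g i j) := by
    intro i j
    by_cases h : j = i
    · simpa only [g, if_pos h] using hfc
    · simpa only [g, if_neg h] using continuous_const
  have hg0 : ∀ i j v, 0 ≤ g i j v := by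
    intro i j v
    simp only [g]; split_ifs
    · exact hf0 v
    · exact zero_le_one
  have hgint : ∀ i j, Integrable (g i j) B := fun i j =>
    (hgc i j).integrable_of_hasCompactSupport (HasCompactSupport.of_compactSpace _)
  have hintf : ∀ h : unitInterval → ℝ, ∫ v, h v ∂B = q * h 1 + (1 - q) * h 0 :=
    integral_bernoulliLoss hq0 hq1
  have hq0' : q ≠ 0 := (left_ne_zero_of_mul hqq.ne')
  have hq1' : 1 - q ≠ 0 := (right_ne_zero_of_mul hqq.ne')
  have hg1 : ∀ i j, ∫ v, g i j v ∂B = 1 := by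
    intro i j
    rw [hintf]
    simp only [g, f]; split_ifs
    · simp only [Set.Icc.coe_one, Set.Icc.coe_zero]; field_simp; ring
    · ring
  let p : Fin K → Fin K → Measure unitInterval := fun i j =>
    B.withDensity fun v => ENNReal.ofReal (g i j v)
  have hprob : ∀ {α : Type} [MeasurableSpace α] (μ : Measure α) (F : α → ℝ), Integrable F μ →
      (∀ x, 0 ≤ F x) → ∫ x, F x ∂μ = 1 →
      IsProbabilityMeasure (μ.withDensity fun x => ENNReal.ofReal (F x)) := by
    intro α _ μ F hF h0 h1
    refine ⟨?_⟩
    rw [withDensity_apply _ MeasurableSet.univ, setLIntegral_univ,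
      ← ofReal_integral_eq_lintegral_ofReal hF (Filter.Eventually.of_forall h0), h1,
      ENNReal.ofReal_one]
  have hp : ∀ i j, IsProbabilityMeasure (p i j) := fun i j =>
    hprob B (g i j) (hgint i j) (hg0 i j) (hg1 i j)
  have hpint : ∀ i j, ∫ v, (v : ℝ) ∂(p i j) = if j = i then q - Δ else q := by
    intro i j
    rw [integral_withDensity_ofReal B (hgc i j).measurable (hg0 i j), hintf]
    simp only [g, f]; split_ifs
    · simp only [Set.Icc.coe_one, Set.Icc.coe_zero]; field_simp; ring
    · simp
  have hgap : ∀ i, HasMinGap (Measure.pi (p i)) i Δ := fun i =>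
    hasMinGap_pi hK (p i) i (m := q) hΔ (by rw [hpint, if_pos rfl])
      fun j hj => by rw [hpint, if_neg hj]
  -- the product laws as densities with respect to the base law
  let ν₀ : Measure (LossVector K) := Measure.pi fun _ => B
  have hν : ∀ i, Measure.pi (p i) = ν₀.withDensity fun x => ENNReal.ofReal (f (x i)) := by
    intro i
    rw [pi_withDensity_ofReal (fun _ => B) (g i) (hgint i) (hg0 i)]
    congr 1
    funext x
    rw [Finset.prod_eq_single i]
    · simp only [g, if_pos]
    · intro j _ hj; simp only [g, if_neg hj]
    · simp
  have hfi : ∀ i, Integrable (fun x : LossVector K => f (x i)) ν₀ := fun i =>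
    (hfc.comp (continuous_apply i)).integrable_of_hasCompactSupport
      (HasCompactSupport.of_compactSpace _)
  have hpow : ∀ (i : Fin K) (t : ℕ), Measure.pi (fun _ : Fin t => Measure.pi (p i)) =
      (Measure.pi fun _ : Fin t => ν₀).withDensity
        fun x => ENNReal.ofReal (∏ s, f (x s i)) := by
    intro i t
    have : IsProbabilityMeasure (ν₀.withDensity fun x => ENNReal.ofReal (f (x i))) := by
      rw [← hν]; infer_instance
    simp_rw [hν]
    exact pi_withDensity_ofReal (fun _ : Fin t => ν₀) (fun _ x => f (x i)) (fun _ => hfi i)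
      (fun _ _ => hf0 _)
  have heval : ∀ (i : Fin K) (h : unitInterval → ℝ), Continuous h →
      ∫ x : LossVector K, h (x i) ∂ν₀ = ∫ v, h v ∂B := by
    intro i h hh
    exact integral_comp_eval (μ := fun _ : Fin K => B) hh.aestronglyMeasurable
  have hsq : ∀ i : Fin K, ∫ x : LossVector K, f (x i) ^ 2 ∂ν₀ = 1 + χ := by
    intro i
    rw [heval i (fun v => f v ^ 2) (by fun_prop), hintf, hχ]
    simp only [f, Set.Icc.coe_one, Set.Icc.coe_zero]
    field_simp; ring
  have hlogK : 0 < Real.log K := Real.log_pos (by exact_mod_cast hK)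
  obtain ⟨r, hr⟩ : ∃ r : ℝ, r = Real.exp (Real.log K / 4) := ⟨_, rfl⟩
  have hr1 : 1.17 ≤ r := hr ▸ le_exp_log_div_four hK
  have hrK : r ^ 4 = K := hr ▸ exp_log_div_four_pow hK
  have hr0 : 0 < r := by linarith
  obtain ⟨i, hi⟩ := alg.exists_le_regret hK (fun i => Measure.pi (p i)) hgap
    (δ * Real.log K / (8 * Δ ^ 2)) (1 / 10) (by positivity) (by norm_num) (by
    intro t ht
    have hLR : ∀ i : Fin K, ∫ x : Fin t → LossVector K, (∏ s, f (x s i)) ^ 2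
        ∂(Measure.pi fun _ => ν₀) = (1 + χ) ^ t := by
      intro i
      simp_rw [← Finset.prod_pow]
      rw [integral_fintype_prod_eq_pow (fun x : LossVector K => f (x i) ^ 2), hsq,
        Fintype.card_fin]
    have hexp : (1 + χ) ^ t ≤ r ^ 2 := by
      calc (1 + χ) ^ t ≤ Real.exp χ ^ t := by
            refine pow_le_pow_left₀ (by positivity) ?_ t
            linarith [Real.add_one_le_exp χ]
        _ = Real.exp (t * χ) := by rw [← Real.exp_nat_mul]
        _ ≤ Real.exp (Real.log K / 2) := by
            refine Real.exp_le_exp.2 ?_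
            calc (t : ℝ) * χ ≤ δ * Real.log K / (8 * Δ ^ 2) * (4 * Δ ^ 2 / δ) := by
                  gcongr
              _ = Real.log K / 2 := by field_simp; norm_num
        _ = r ^ 2 := by
            rw [hr, ← Real.exp_nat_mul]; congr 1; push_cast; ring
    -- Change of measure by the arithmetic-geometric mean: `2 F n ≤ F² / z + z n²` with `n² ≤ n` for
    -- a probability `n`. The choice `z = r³` makes both terms contribute `r³` after summing over
    -- `i`.
    have hbound : ∀ i : Fin K, ∫ x, (alg.nextLaw t x i).toReal
        ∂(Measure.pi fun _ : Fin t => Measure.pi (p i)) ≤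
        (1 / r ^ 3 * r ^ 2 + r ^ 3 * ∫ x, (alg.nextLaw t x i).toReal
          ∂(Measure.pi fun _ : Fin t => ν₀)) / 2 := by
      intro i
      have hFc : Continuous fun x : Fin t → LossVector K => ∏ s, f (x s i) := by fun_prop
      have hF2 : Integrable (fun x : Fin t → LossVector K => (∏ s, f (x s i)) ^ 2)
          (Measure.pi fun _ => ν₀) :=
        (hFc.pow 2).integrable_of_hasCompactSupport (HasCompactSupport.of_compactSpace _)
      have hn := alg.integrable_nextLaw t i (Measure.pi fun _ => ν₀)
      rw [hpow, integral_withDensity_ofReal _ hFc.measurable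
        (fun x => Finset.prod_nonneg fun s _ => hf0 _)]
      calc ∫ x : Fin t → LossVector K, (∏ s, f (x s i)) * (alg.nextLaw t x i).toReal
            ∂(Measure.pi fun _ => ν₀)
          ≤ ∫ x : Fin t → LossVector K, (1 / r ^ 3 * (∏ s, f (x s i)) ^ 2
              + r ^ 3 * (alg.nextLaw t x i).toReal) / 2 ∂(Measure.pi fun _ => ν₀) := by
            refine integral_mono_of_nonneg (Filter.Eventually.of_forall fun x => ?_)
              (((hF2.const_mul _).add (hn.const_mul _)).div_const 2)
              (Filter.Eventually.of_forall fun x => ?_)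
            · exact mul_nonneg (Finset.prod_nonneg fun s _ => hf0 _) ENNReal.toReal_nonneg
            · simp only
              have h1 : (alg.nextLaw t x i).toReal ≤ 1 := PMF.toReal_apply_le_one _ _
              have h0 : 0 ≤ (alg.nextLaw t x i).toReal := ENNReal.toReal_nonneg
              generalize (alg.nextLaw t x i).toReal = n at *
              generalize (∏ s, f (x s i)) = F at *
              have hr3 : 0 < r ^ 3 := by positivity
              generalize r ^ 3 = z at *
              have key : 0 ≤ (F - z * n) ^ 2 / z := by positivity
              have e : (F - z * n) ^ 2 / z = 1 / z * F ^ 2 - 2 * (F * n) + z * n ^ 2 := by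
                field_simp
                ring
              have : z * n ^ 2 ≤ z * n := by
                apply mul_le_mul_of_nonneg_left _ hr3.le
                nlinarith
              linarith
        _ = (1 / r ^ 3 * ∫ x : Fin t → LossVector K, (∏ s, f (x s i)) ^ 2
              ∂(Measure.pi fun _ => ν₀) + r ^ 3 * ∫ x, (alg.nextLaw t x i).toReal
              ∂(Measure.pi fun _ : Fin t => ν₀)) / 2 := by
            rw [integral_div, integral_add (hF2.const_mul _) (hn.const_mul _),
              integral_const_mul, integral_const_mul]
        _ ≤ _ := by
            rw [hLR]
            gcongr
    refine (Finset.sum_le_sum fun i _ => hbound i).trans ?_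
    rw [← Finset.sum_div, Finset.sum_add_distrib, ← Finset.mul_sum (a := r ^ 3), OnlineAlgorithm.sum_integral_nextLaw]
    simp only [Finset.sum_const, Finset.card_univ, Fintype.card_fin, nsmul_eq_mul]
    rw [← hrK, show r ^ 4 * (1 / r ^ 3 * r ^ 2) = r ^ 3 by field_simp]
    -- The sum over `i` is at most `r³ ≤ K / 1.17`, below `(9/10) K`.
    have : r ^ 3 * 1.17 ≤ r ^ 3 * r := by gcongr
    nlinarith [pow_pos hr0 3]) T
  exact ⟨p i, i, hp i, hgap i, hi⟩

/-- The privacy part of the lower bound. -/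
theorem exists_le_regret_of_isDP {alg : OnlineAlgorithm K} {ε : ℝ} (halg : alg.IsDP ε)
    (hK : 2 ≤ K) (hε : 0 < ε) {Δ : ℝ} (hΔ : 0 < Δ) (hΔ1 : Δ ≤ 1) (T : ℕ) :
    ∃ (p : Fin K → Measure unitInterval) (best : Fin K),
      (∀ j, IsProbabilityMeasure (p j)) ∧ HasMinGap (Measure.pi p) best Δ ∧
      1 / 10 * (Δ * min (T : ℝ) (Real.log K / (16 * ε * Δ)))
        ≤ alg.regret (Measure.pi p) best T := by
  let B := bernoulliLoss Δ
  have hB : IsProbabilityMeasure B := isProbabilityMeasure_bernoulliLoss hΔ.le hΔ1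
  have hintf : ∀ h : unitInterval → ℝ, ∫ v, h v ∂B = Δ * h 1 + (1 - Δ) * h 0 :=
    integral_bernoulliLoss hΔ.le hΔ1
  -- A coupling: instance `i` is the base law with the losses of action `i` erased. A loss vector
  -- changes only if its `i`-th loss was `1`, which has probability `Δ`.
  let φ : Fin K → Fin K → unitInterval → unitInterval := fun i j v => if j = i then 0 else v
  have hφ : ∀ i j, Measurable (φ i j) := by
    intro i j
    by_cases h : j = i
    · simpa only [φ, if_pos h] using measurable_const
    · simp only [φ, if_neg h]; exact measurable_id
  let p : Fin K → Fin K → Measure unitInterval := fun i j => B.map (φ i j)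
  have hp : ∀ i j, IsProbabilityMeasure (p i j) := fun i j =>
    Measure.isProbabilityMeasure_map (hφ i j).aemeasurable
  have hgap : ∀ i, HasMinGap (Measure.pi (p i)) i Δ := by
    intro i
    have hmean : ∀ j, ∫ v, (v : ℝ) ∂(p i j) = if j = i then 0 else Δ := by
      intro j
      rw [integral_map (hφ i j).aemeasurable (by fun_prop), hintf]
      simp only [φ]
      split_ifs <;> simp
    exact hasMinGap_pi hK (p i) i (m := Δ) hΔ (by rw [hmean, if_pos rfl, sub_self])
      fun j hj => by rw [hmean, if_neg hj]
  let ν₀ : Measure (LossVector K) := Measure.pi fun _ => B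
  let Φ : Fin K → LossVector K → LossVector K := fun i x j => φ i j (x j)
  have hΦ : ∀ i, Measurable (Φ i) := fun i =>
    measurable_pi_lambda _ fun j => (hφ i j).comp (measurable_pi_apply j)
  have hν : ∀ i, Measure.pi (p i) = ν₀.map (Φ i) := by
    intro i
    have : ∀ j, IsProbabilityMeasure (B.map (φ i j)) := hp i
    exact (Measure.pi_map_pi (μ := fun _ : Fin K => B) fun j => (hφ i j).aemeasurable).symm
  have hpow : ∀ (i : Fin K) (t : ℕ), Measure.pi (fun _ : Fin t => Measure.pi (p i)) =
      (Measure.pi fun _ : Fin t => ν₀).map fun x s => Φ i (x s) := by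
    intro i t
    have : IsProbabilityMeasure (ν₀.map (Φ i)) := by
      rw [← hν]; infer_instance
    simp_rw [hν]
    exact (Measure.pi_map_pi (μ := fun _ : Fin t => ν₀) fun _ => (hΦ i).aemeasurable).symm
  have hlogK : 0 < Real.log K := Real.log_pos (by exact_mod_cast hK)
  obtain ⟨r, hr⟩ : ∃ r : ℝ, r = Real.exp (Real.log K / 4) := ⟨_, rfl⟩
  have hr1 : 1.17 ≤ r := hr ▸ le_exp_log_div_four hK
  have hrK : r ^ 4 = K := hr ▸ exp_log_div_four_pow hK
  have hr0 : 0 < r := by linarith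
  -- The number of changes that group privacy tolerates at the price of a factor `√K = r²`.
  obtain ⟨u, hu⟩ : ∃ u : ℝ, u = Real.log K / (2 * ε) := ⟨_, rfl⟩
  have hu0 : 0 < u := by rw [hu]; positivity
  have hru : Real.exp (ε * u) = r ^ 2 := by
    rw [hr, ← Real.exp_nat_mul, hu]; congr 1; push_cast; field_simp; norm_num
  let χ : unitInterval → ℝ := fun v => if v = 0 then 0 else 1
  have hχm : Measurable χ := Measurable.ite (measurableSet_singleton 0) measurable_const
    measurable_const
  have hχB : ∀ i : Fin K, ∫ x : LossVector K, χ (x i) ∂ν₀ = Δ := by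
    intro i
    have h1 : ∫ v, χ v ∂B = Δ := by rw [hintf]; simp [χ]
    rw [← h1]
    exact integral_comp_eval (μ := fun _ : Fin K => B) hχm.aestronglyMeasurable
  obtain ⟨i, hi⟩ := alg.exists_le_regret hK (fun i => Measure.pi (p i)) hgap
    (Real.log K / (16 * ε * Δ)) (1 / 10) (by positivity) (by norm_num) (by
    intro t ht
    have hχt : ∀ (i : Fin K) (s : Fin t), Integrable (fun x : Fin t → LossVector K => χ (x s i))
        (Measure.pi fun _ => ν₀) := by
      intro i s
      refine integrable_of_measurable_of_abs_le (hχm.comp (by fun_prop)) 1 fun x => ?_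
      simp only [χ]; split_ifs <;> simp
    have hcount : ∀ i : Fin K, ∫ x : Fin t → LossVector K, ∑ s, χ (x s i)
        ∂(Measure.pi fun _ => ν₀) = t * Δ := by
      intro i
      rw [integral_finsetSum _ fun s _ => hχt i s]
      have : ∀ s : Fin t, ∫ x : Fin t → LossVector K, χ (x s i) ∂(Measure.pi fun _ => ν₀) = Δ := by
        intro s
        have hm2 : Measurable fun x : LossVector K => χ (x i) := hχm.comp (measurable_pi_apply i)
        rw [← hχB i]
        exact integral_comp_eval (μ := fun _ : Fin t => ν₀) hm2.aestronglyMeasurable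
      simp [this]
    have hbound : ∀ i : Fin K, ∫ x, (alg.nextLaw t x i).toReal
        ∂(Measure.pi fun _ : Fin t => Measure.pi (p i)) ≤
        r ^ 2 * ∫ x, (alg.nextLaw t x i).toReal ∂(Measure.pi fun _ : Fin t => ν₀)
          + (t * Δ) / u := by
      intro i
      have hΦt : Measurable fun (x : Fin t → LossVector K) s => Φ i (x s) :=
        measurable_pi_lambda _ fun s => (hΦ i).comp (measurable_pi_apply s)
      have hn := alg.integrable_nextLaw t i (Measure.pi fun _ => ν₀)
      have hsum : Integrable (fun x : Fin t → LossVector K => (∑ s, χ (x s i)) / u)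
          (Measure.pi fun _ => ν₀) := (integrable_finsetSum _ fun s _ => hχt i s).div_const u
      rw [hpow, integral_map hΦt.aemeasurable (alg.measurable_nextLaw t i).aestronglyMeasurable,
        ← hcount i, ← integral_div, ← integral_const_mul, ← integral_add (hn.const_mul _) hsum]
      refine integral_mono_of_nonneg (Filter.Eventually.of_forall fun x =>
        ENNReal.toReal_nonneg) ((hn.const_mul _).add hsum)
        (Filter.Eventually.of_forall fun x => ?_)
      simp only
      have hn0 : 0 ≤ (alg.nextLaw t x i).toReal := ENNReal.toReal_nonneg
      let D : Finset (Fin t) := Finset.univ.filter fun s => x s i ≠ 0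
      have hD : ∑ s, χ (x s i) = D.card := by
        simp only [χ, D, Finset.card_filter, Nat.cast_sum]
        refine Finset.sum_congr rfl fun s _ => ?_
        split_ifs with h1 h2 <;> simp_all
      rw [hD]
      -- Few changes: group privacy. Many changes: the probability is at most `1 ≤ D.card / u`, a
      -- Markov bound whose expectation is `tΔ / u`.
      by_cases hDu : (D.card : ℝ) ≤ u
      · have h1 := halg.nextLaw_le_card x i D (fun s => Φ i (x s)) (by
          intro s hs
          have hs0 : x s i = 0 := by simpa [D] using hs
          funext j
          simp only [Φ, φ]
          split_ifs with hj
          · rw [hj, hs0]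
          · rfl)
        have h2 : Real.exp (ε * D.card) ≤ r ^ 2 := by
          rw [← hru]
          exact Real.exp_le_exp.2 (by gcongr)
        have h3 := mul_le_mul_of_nonneg_right h2 hn0
        have h4 : 0 ≤ (D.card : ℝ) / u := by positivity
        linarith
      · have h1 : 1 ≤ (D.card : ℝ) / u := by
          rw [one_le_div hu0]; exact (not_le.1 hDu).le
        have h2 : (alg.nextLaw t (fun s => Φ i (x s)) i).toReal ≤ 1 :=
          PMF.toReal_apply_le_one _ _
        have h3 : 0 ≤ r ^ 2 * (alg.nextLaw t x i).toReal := by positivity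
        linarith
    refine (Finset.sum_le_sum fun i _ => hbound i).trans ?_
    rw [Finset.sum_add_distrib, ← Finset.mul_sum, OnlineAlgorithm.sum_integral_nextLaw]
    simp only [Finset.sum_const, Finset.card_univ, Fintype.card_fin, nsmul_eq_mul]
    have h1 : (t * Δ) / u ≤ 1 / 8 := by
      calc (t * Δ) / u ≤ (Real.log K / (16 * ε * Δ) * Δ) / u := by gcongr
        _ = 1 / 8 := by rw [hu]; field_simp; norm_num
    rw [← hrK]
    have h2 : r ^ 4 * ((t * Δ) / u) ≤ r ^ 4 * (1 / 8) := by gcongr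
    -- Numerically `1 / 1.17² + 1/8 < 9/10`.
    have h3 : (1.17 : ℝ) ^ 2 ≤ r ^ 2 := by gcongr
    nlinarith [pow_pos hr0 2]) T
  exact ⟨p i, i, hp i, hgap i, hi⟩

/-- The two lower bounds combined. -/
theorem exists_const_forall_exists_le_regret {δ : ℝ} (hδ : 0 < δ) (hδ1 : δ < 1) :
    ∃ c : ℝ, 0 < c ∧
      ∀ K : ℕ, 2 ≤ K → ∀ ε : ℝ, 0 < ε → ∀ Δ : ℝ, 0 < Δ → Δ ≤ 1 →
        (Δ ≤ 1 - δ ∨ ε ≤ 1 / δ) →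
        ∀ alg : OnlineAlgorithm K, alg.IsDP ε → ∀ T : ℕ,
          ∃ (p : Fin K → Measure unitInterval) (best : Fin K),
            (∀ j, IsProbabilityMeasure (p j)) ∧
            HasMinGap (Measure.pi p) best Δ ∧
            c * min (T * Δ) (Real.log K / Δ + Real.log K / ε)
              ≤ alg.regret (Measure.pi p) best T := by
  have hd : 0 < 1 - δ := by linarith
  -- The two bounds have constants `δ / 80` and `1 / 160`. The factor `δ (1 - δ)` compares the two
  -- rates, and another `2` pays for their sum.
  refine ⟨δ * (1 - δ) / 320, by positivity, ?_⟩
  intro K hK ε hε Δ hΔ hΔ1 hcase alg halg T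
  have hlogK : 0 < Real.log K := Real.log_pos (by exact_mod_cast hK)
  have hδδ : δ * (1 - δ) ≤ 1 := by nlinarith
  have hprod : 0 < δ * (1 - δ) := by positivity
  by_cases hA : Δ ≤ 1 - δ ∧ Δ ≤ ε
  · obtain ⟨p, best, hp, hgap, hreg⟩ := exists_le_regret_of_gap_lt_one alg hK hδ hΔ hA.1 T
    refine ⟨p, best, hp, hgap, le_trans ?_ hreg⟩
    have hle : Real.log K / ε ≤ Real.log K / Δ :=
      div_le_div_of_nonneg_left hlogK.le hΔ hA.2
    rw [mul_min_of_nonneg _ _ hΔ.le, mul_min_of_nonneg _ _ (by norm_num : (0 : ℝ) ≤ 1 / 10),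
      mul_min_of_nonneg _ _ (by positivity)]
    have e : Δ * (δ * Real.log K / (8 * Δ ^ 2)) = δ / 8 * (Real.log K / Δ) := by field_simp
    rw [e]
    have ha : 0 < Real.log K / Δ := by positivity
    refine min_le_min ?_ ?_
    · have : 0 ≤ T * Δ := by positivity
      nlinarith
    · calc δ * (1 - δ) / 320 * (Real.log K / Δ + Real.log K / ε)
          ≤ δ * (1 - δ) / 320 * (Real.log K / Δ + Real.log K / Δ) := by gcongr
        _ ≤ δ * 1 / 320 * (Real.log K / Δ + Real.log K / Δ) := by gcongr; linarith
        _ ≤ _ := by nlinarith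
  · obtain ⟨p, best, hp, hgap, hreg⟩ := exists_le_regret_of_isDP halg hK hε hΔ hΔ1 T
    refine ⟨p, best, hp, hgap, le_trans ?_ hreg⟩
    -- Here the privacy rate dominates: either `ε < Δ`, or `Δ > 1 - δ` and then `ε ≤ 1 / δ`.
    have hle : δ * (1 - δ) * (Real.log K / Δ) ≤ Real.log K / ε := by
      rw [mul_div_assoc', div_le_div_iff₀ hΔ hε]
      suffices h : δ * (1 - δ) * ε ≤ Δ by
        calc δ * (1 - δ) * Real.log K * ε = Real.log K * (δ * (1 - δ) * ε) := by ring
          _ ≤ Real.log K * Δ := by gcongr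
      by_cases h1 : Δ ≤ 1 - δ
      · have h2 : ε < Δ := not_le.1 fun h => hA ⟨h1, h⟩
        nlinarith
      · have h2 : ε ≤ 1 / δ := hcase.resolve_left h1
        calc δ * (1 - δ) * ε ≤ δ * (1 - δ) * (1 / δ) := by gcongr
          _ = 1 - δ := by field_simp
          _ ≤ Δ := (not_le.1 h1).le
    rw [mul_min_of_nonneg _ _ hΔ.le, mul_min_of_nonneg _ _ (by norm_num : (0 : ℝ) ≤ 1 / 10),
      mul_min_of_nonneg _ _ (by positivity)]
    have e : Δ * (Real.log K / (16 * ε * Δ)) = 1 / 16 * (Real.log K / ε) := by field_simp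
    rw [e]
    have hb : 0 < Real.log K / ε := by positivity
    refine min_le_min ?_ ?_
    · have : 0 ≤ T * Δ := by positivity
      nlinarith
    · nlinarith

end LowerBounds

/-! ### Privacy of the randomized-prefix softmax algorithm. -/

section Privacy

variable {K : ℕ}

/-- Adaptive composition: the probability of a fixed action sequence is a product of policy
probabilities, so the ratio bounds multiply. -/
theorem OnlineAlgorithm.law_le_prod_mul (alg : OnlineAlgorithm K) (c : ℕ → ENNReal)
    (y y' : ℕ → LossVector K)
    (h : ∀ (s : ℕ) (a : Fin s → Fin K) (b : Fin K),
      alg.policy s (fun i => y i) a b ≤ c s * alg.policy s (fun i => y' i) a b)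
    (t : ℕ) (a : Fin t → Fin K) :
    alg.law t (fun i => y i) a ≤ (∏ s ∈ Finset.range t, c s) * alg.law t (fun i => y' i) a := by
  induction t with
  | zero => simp only [law, Finset.range_zero, Finset.prod_empty, one_mul, le_refl]
  | succ t ih =>
    obtain ⟨⟨b, a⟩, rfl⟩ := (Fin.snocEquiv fun _ : Fin (t + 1) => Fin K).surjective a
    have he : (Fin.snocEquiv fun _ : Fin (t + 1) => Fin K) (b, a) = Fin.snoc a b := rfl
    rw [he, law_succ_snoc, law_succ_snoc, Finset.prod_range_succ]
    calc _ ≤ ((∏ s ∈ Finset.range t, c s) * alg.law t (fun i => y' i) a)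
          * (c t * alg.policy t (fun i => y' i) a b) := mul_le_mul' (ih a) (h t a b)
      _ = _ := by
        simp only [Fin.val_castSucc]
        ring

theorem prefixLengthPMF_eq_zero_of_lt {r m : ℕ} (h : 2 ^ r < m) : prefixLengthPMF r m = 0 := by
  rw [prefixLengthPMF]
  refine PMF.uniformOfFinset_apply_of_notMem _ ?_
  simp only [Finset.mem_Ioc, not_and, not_le]
  exact fun _ => h

/-- The entry `s₀` is the loss of round `s₀ + 1`, in block `Nat.log 2 (s₀ + 1)`; the bound on `m`
keeps the prefix inside block `r`. -/
theorem blockPrefixLoss_eq {t : ℕ} (y y' : ℕ → LossVector K) (s₀ r m : ℕ)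
    (h : ∀ s, s ≠ s₀ → y s = y' s) (hr : r ≠ Nat.log 2 (s₀ + 1)) (hm : m ≤ 2 ^ r) :
    (blockPrefixLoss (fun i : Fin t => y i) r m) = blockPrefixLoss (fun i : Fin t => y' i) r m := by
  funext j
  unfold blockPrefixLoss
  refine Finset.sum_congr rfl fun i _ => ?_
  split_ifs with hi
  · have hne : (i : ℕ) ≠ s₀ := by
      intro he
      apply hr
      rw [he] at hi
      symm
      rw [Nat.log_eq_iff (Or.inr ⟨by norm_num, by omega⟩)]
      exact ⟨hi.1, by rw [pow_succ]; omega⟩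
    simp only [h i hne]
  · rfl

theorem abs_blockPrefixLoss_sub_le {t : ℕ} (y y' : ℕ → LossVector K) (s₀ r m : ℕ)
    (h : ∀ s, s ≠ s₀ → y s = y' s) (j : Fin K) :
    |blockPrefixLoss (fun i : Fin t => y i) r m j
      - blockPrefixLoss (fun i : Fin t => y' i) r m j| ≤ 1 := by
  unfold blockPrefixLoss
  rw [← Finset.sum_sub_distrib]
  refine (Finset.abs_sum_le_sum_abs _ _).trans ?_
  calc _ ≤ ∑ i : Fin t, if (i : ℕ) = s₀ then (1 : ℝ) else 0 := by
        refine Finset.sum_le_sum fun i _ => ?_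
        by_cases hi : (i : ℕ) = s₀
        · rw [if_pos hi]
          split_ifs
          · rw [abs_le]
            constructor <;> linarith [(y i j).2.1, (y i j).2.2, (y' i j).2.1, (y' i j).2.2]
          · simp
        · simp [if_neg hi, h i hi]
    _ ≤ 1 := by
        by_cases hs : s₀ < t
        · rw [Finset.sum_eq_single (⟨s₀, hs⟩ : Fin t)]
          · simp
          · intro i _ hi
            rw [if_neg]
            exact fun he => hi (Fin.ext he)
          · simp
        · rw [Finset.sum_eq_zero]
          · norm_num
          · intro i _
            rw [if_neg]
            have := i.2
            omega

variable [NeZero K]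

theorem softmaxPMF_apply (η : ℝ) (L : Fin K → ℝ) (b : Fin K) :
    softmaxPMF η L b =
      ENNReal.ofReal (Real.exp (-η * L b) / ∑ j, Real.exp (-η * L j)) := by
  have hpos : 0 < ∑ j, Real.exp (-η * L j) :=
    Finset.sum_pos (fun j _ => Real.exp_pos _) ⟨0, Finset.mem_univ _⟩
  rw [softmaxPMF, PMF.normalize_apply, tsum_fintype,
    ← ENNReal.ofReal_sum_of_nonneg fun j _ => (Real.exp_pos _).le,
    ENNReal.ofReal_div_of_pos hpos, div_eq_mul_inv]

/-- The exponential mechanism is private. -/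
theorem softmaxPMF_le {η : ℝ} (hη : 0 ≤ η) (L L' : Fin K → ℝ) (h : ∀ j, |L j - L' j| ≤ 1)
    (b : Fin K) :
    softmaxPMF η L b ≤ ENNReal.ofReal (Real.exp (2 * η)) * softmaxPMF η L' b := by
  have key : ∀ L L' : Fin K → ℝ, (∀ j, |L j - L' j| ≤ 1) → ∀ j,
      Real.exp (-η * L j) ≤ Real.exp η * Real.exp (-η * L' j) := by
    intro L L' h j
    rw [← Real.exp_add]
    refine Real.exp_le_exp.2 ?_
    have := mul_le_mul_of_nonneg_left (abs_le.1 (h j)).1 hη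
    linarith
  have hpos : ∀ L : Fin K → ℝ, 0 < ∑ j, Real.exp (-η * L j) := fun L =>
    Finset.sum_pos (fun j _ => Real.exp_pos _) ⟨0, Finset.mem_univ _⟩
  rw [softmaxPMF_apply, softmaxPMF_apply, ← ENNReal.ofReal_mul (Real.exp_pos _).le]
  refine ENNReal.ofReal_le_ofReal ?_
  have hsum : ∑ j, Real.exp (-η * L' j) ≤ Real.exp η * ∑ j, Real.exp (-η * L j) := by
    rw [Finset.mul_sum]
    exact Finset.sum_le_sum fun j _ => key L' L (fun j => by rw [abs_sub_comm]; exact h j) j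
  rw [mul_div_assoc', div_le_div_iff₀ (hpos L) (hpos L'), two_mul, Real.exp_add]
  calc _ ≤ (Real.exp η * Real.exp (-η * L' b)) * (Real.exp η * ∑ j, Real.exp (-η * L j)) :=
        mul_le_mul (key L L' h b) hsum (hpos L').le (by positivity)
    _ = _ := by ring

/-- Only the draw in round `2 ^ (Nat.log 2 (s₀ + 1) + 1)`, whose index is one less, reads entry
`s₀`. The bound holds for each prefix length, hence for the mixture. -/
theorem randomizedPrefixPolicy_le {η : ℝ} (hη : 0 ≤ η) (p₀ : PMF (Fin K))
    (y y' : ℕ → LossVector K) (s₀ : ℕ) (h : ∀ s, s ≠ s₀ → y s = y' s) (t : ℕ)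
    (a : Fin t → Fin K) (b : Fin K) :
    randomizedPrefixPolicy η p₀ t (fun i => y i) a b ≤
      (if t = 2 ^ (Nat.log 2 (s₀ + 1) + 1) - 1 then ENNReal.ofReal (Real.exp (2 * η)) else 1) *
        randomizedPrefixPolicy η p₀ t (fun i => y' i) a b := by
  have hone : (1 : ENNReal) ≤
      if t = 2 ^ (Nat.log 2 (s₀ + 1) + 1) - 1 then ENNReal.ofReal (Real.exp (2 * η)) else 1 := by
    split_ifs
    · rw [ENNReal.one_le_ofReal]
      exact Real.one_le_exp (by positivity)
    · exact le_rfl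
  have hself : ∀ z : ENNReal, z ≤ (if t = 2 ^ (Nat.log 2 (s₀ + 1) + 1) - 1 then
      ENNReal.ofReal (Real.exp (2 * η)) else 1) * z := fun z => by
    simpa using mul_le_mul_left hone z
  unfold randomizedPrefixPolicy
  by_cases ht : t = 0
  · rw [dif_pos ht, dif_pos ht]
    exact hself _
  rw [dif_neg ht, dif_neg ht]
  by_cases hb : t + 1 = 2 ^ Nat.log 2 (t + 1)
  swap
  · rw [if_neg hb, if_neg hb]
    exact hself _
  rw [if_pos hb, if_pos hb]
  split_ifs with hts
  · rw [PMF.bind_apply, PMF.bind_apply, ← ENNReal.tsum_mul_left]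
    refine ENNReal.tsum_le_tsum fun m => ?_
    rw [mul_left_comm]
    refine mul_le_mul_right ?_ _
    exact softmaxPMF_le hη _ _ (abs_blockPrefixLoss_sub_le y y' s₀ _ m h) b
  · rw [one_mul, PMF.bind_apply, PMF.bind_apply]
    refine ENNReal.tsum_le_tsum fun m => ?_
    by_cases hm : m ≤ 2 ^ (Nat.log 2 (t + 1) - 1)
    · rw [blockPrefixLoss_eq y y' s₀ _ m h ?_ hm]
      intro he
      apply hts
      have h1 : 1 ≤ Nat.log 2 (t + 1) := Nat.log_pos (by norm_num) (by omega)
      rw [← he, Nat.sub_add_cancel h1, ← hb]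
      rfl
    · rw [prefixLengthPMF_eq_zero_of_lt (not_le.1 hm)]
      simp only [zero_mul, le_refl]

theorem randomizedPrefixSoftmax_isDP {ε : ℝ} (hε : 0 < ε) (p₀ : PMF (Fin K)) :
    (randomizedPrefixSoftmax ε p₀).IsDP ε := by
  intro t x x' hx S
  have hη : 0 ≤ min (ε / 2) (1 / 8) := le_min (by positivity) (by norm_num)
  have hηε : 2 * min (ε / 2) (1 / 8) ≤ ε := by linarith [min_le_left (ε / 2) (1 / 8)]
  let y : ℕ → LossVector K := fun s => if h : s < t then x ⟨s, h⟩ else fun _ => 0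
  let y' : ℕ → LossVector K := fun s => if h : s < t then x' ⟨s, h⟩ else fun _ => 0
  have hy : x = fun i : Fin t => y i := by funext i; simp [y]
  have hy' : x' = fun i : Fin t => y' i := by funext i; simp [y']
  obtain ⟨s₀, hs₀⟩ : ∃ s₀, ∀ s, s ≠ s₀ → y s = y' s := by
    by_cases hne : ∃ s, x s ≠ x' s
    · obtain ⟨s₁, hs₁⟩ := hne
      refine ⟨s₁, fun s hs => ?_⟩
      by_cases hst : s < t
      · by_contra hcon
        simp only [y, y', dif_pos hst] at hcon
        exact hs (congrArg Fin.val (hx hcon hs₁))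
      · simp only [y, y', dif_neg hst]
    · push Not at hne
      refine ⟨0, fun s _ => ?_⟩
      by_cases hst : s < t
      · simp only [y, y', dif_pos hst, hne]
      · simp only [y, y', dif_neg hst]
  have key : ∀ a, (randomizedPrefixSoftmax ε p₀).law t x a ≤
      ENNReal.ofReal (Real.exp ε) * (randomizedPrefixSoftmax ε p₀).law t x' a := by
    intro a
    rw [hy, hy']
    refine ((randomizedPrefixSoftmax ε p₀).law_le_prod_mul _ y y'
      (fun s a b => randomizedPrefixPolicy_le hη p₀ y y' s₀ hs₀ s a b) t a).trans ?_
    refine mul_le_mul_left ?_ _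
    rw [Finset.prod_ite_eq']
    split_ifs
    · exact ENNReal.ofReal_le_ofReal (Real.exp_le_exp.2 hηε)
    · rw [ENNReal.one_le_ofReal]
      exact Real.one_le_exp hε.le
  rw [PMF.toMeasure_apply_fintype, PMF.toMeasure_apply_fintype, Finset.mul_sum]
  refine Finset.sum_le_sum fun a _ => ?_
  by_cases ha : a ∈ S
  · simpa only [Set.indicator_of_mem ha] using key a
  · simp [Set.indicator_of_notMem ha]

end Privacy

/-! ### Exponential weights with a constant learning rate on i.i.d. losses. -/

section Hedge

variable {K : ℕ}

/-- The weight of action `b` in the exponential-weights distribution. -/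
noncomputable def softWeight (η : ℝ) (L : Fin K → ℝ) (b : Fin K) : ℝ :=
  Real.exp (-η * L b) / ∑ j, Real.exp (-η * L j)

theorem softWeight_nonneg (η : ℝ) (L : Fin K → ℝ) (b : Fin K) : 0 ≤ softWeight η L b :=
  div_nonneg (Real.exp_pos _).le (Finset.sum_nonneg fun _ _ => (Real.exp_pos _).le)

theorem sum_exp_pos [NeZero K] (f : Fin K → ℝ) : 0 < ∑ j, Real.exp (f j) :=
  Finset.sum_pos (fun _ _ => Real.exp_pos _) ⟨0, Finset.mem_univ _⟩

theorem sum_softWeight [NeZero K] (η : ℝ) (L : Fin K → ℝ) : ∑ b, softWeight η L b = 1 := by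
  simp only [softWeight]
  rw [← Finset.sum_div, div_self (sum_exp_pos _).ne']

theorem softWeight_le_one [NeZero K] (η : ℝ) (L : Fin K → ℝ) (b : Fin K) :
    softWeight η L b ≤ 1 := by
  rw [← sum_softWeight η L]
  exact Finset.single_le_sum (fun b _ => softWeight_nonneg η L b) (Finset.mem_univ b)

theorem softmaxPMF_toReal [NeZero K] (η : ℝ) (L : Fin K → ℝ) (b : Fin K) :
    (softmaxPMF η L b).toReal = softWeight η L b := by
  rw [softmaxPMF_apply, softWeight]
  exact ENNReal.toReal_ofReal (softWeight_nonneg η L b)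

theorem softWeight_sub_const (η : ℝ) (L : Fin K → ℝ) (a : ℝ) (b : Fin K) :
    softWeight η (fun j => L j - a) b = softWeight η L b := by
  have h : ∀ j, Real.exp (-η * (L j - a)) = Real.exp (-η * L j) * Real.exp (η * a) := by
    intro j
    rw [← Real.exp_add]
    congr 1
    ring
  simp only [softWeight, h]
  rw [← Finset.sum_mul, mul_div_mul_right _ _ (Real.exp_pos _).ne']

theorem continuous_softWeight [NeZero K] {X : Type*} [TopologicalSpace X] (η : ℝ)
    (L : X → Fin K → ℝ) (hL : ∀ j, Continuous fun x => L x j) (b : Fin K) :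
    Continuous fun x => softWeight η (L x) b := by
  unfold softWeight
  refine Continuous.div ?_ ?_ fun x => (sum_exp_pos _).ne'
  · exact Real.continuous_exp.comp ((hL b).const_mul (-η))
  · exact continuous_finsetSum _ fun j _ => Real.continuous_exp.comp ((hL j).const_mul (-η))

theorem Continuous.integrable_of_compactSpace {X : Type*} [TopologicalSpace X] [CompactSpace X]
    [MeasurableSpace X] [OpensMeasurableSpace X] {μ : Measure X} [IsFiniteMeasure μ] {f : X → ℝ}
    (hf : Continuous f) : Integrable f μ :=
  hf.integrable_of_hasCompactSupport (HasCompactSupport.of_compactSpace _)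

/-- The cumulative loss of action `b` in excess of that of `best`. -/
noncomputable def excessLoss (best : Fin K) {m : ℕ} (x : Fin m → LossVector K) (b : Fin K) : ℝ :=
  ∑ s, ((x s b : ℝ) - x s best)

theorem continuous_excessLoss (best : Fin K) {m : ℕ} (b : Fin K) :
    Continuous fun x : Fin m → LossVector K => excessLoss best x b := by
  unfold excessLoss
  fun_prop

theorem excessLoss_best (best : Fin K) {m : ℕ} (x : Fin m → LossVector K) :
    excessLoss best x best = 0 := by simp [excessLoss]

/-- The expected gap of the action drawn by exponential weights from `m` samples. -/
noncomputable def hedgeGap (η : ℝ) (ν : Measure (LossVector K)) (best : Fin K) (m : ℕ) : ℝ :=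
  ∫ x : Fin m → LossVector K, ∑ b, softWeight η (excessLoss best x) b *
    (meanLoss ν b - meanLoss ν best) ∂(Measure.pi fun _ => ν)

/-- The expected logarithm of the partition function after `m` samples. -/
noncomputable def logPartition (η : ℝ) (ν : Measure (LossVector K)) (best : Fin K) (m : ℕ) : ℝ :=
  ∫ x : Fin m → LossVector K, Real.log (∑ j, Real.exp (-η * excessLoss best x j))
    ∂(Measure.pi fun _ => ν)

/-- The expected deviation of the gaps from twice their estimates, under the exponential-weights
distribution. -/
noncomputable def hedgeDeviation (η : ℝ) (ν : Measure (LossVector K)) (best : Fin K) (m : ℕ) :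
    ℝ :=
  ∫ x : Fin m → LossVector K, ∑ b, softWeight η (excessLoss best x) b *
    (meanLoss ν b - meanLoss ν best - 2 / m * excessLoss best x b) ∂(Measure.pi fun _ => ν)

variable (ν : Measure (LossVector K)) (best : Fin K)

/-- The term of `best` alone equals one. -/
theorem logPartition_nonneg (η : ℝ) (m : ℕ) : 0 ≤ logPartition η ν best m := by
  refine integral_nonneg fun x => Real.log_nonneg ?_
  calc (1 : ℝ) = Real.exp (-η * excessLoss best x best) := by rw [excessLoss_best]; simp
    _ ≤ _ := Finset.single_le_sum (f := fun j => Real.exp (-η * excessLoss best x j))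
      (fun j _ => (Real.exp_pos _).le) (Finset.mem_univ best)

variable [IsProbabilityMeasure ν]

theorem logPartition_zero (η : ℝ) : logPartition η ν best 0 = Real.log K := by
  simp [logPartition, excessLoss]

/-- Hoeffding's lemma: doubling the estimate gives the deviation mean minus the gap, and a loss
difference in `[-1, 1]` has variance proxy `1`, whence `m (2l/m)² / 2 = 2l² / m`. -/
theorem integral_exp_deviation_le {m : ℕ} (hm : 0 < m) (l : ℝ) (b : Fin K) :
    ∫ x : Fin m → LossVector K, Real.exp (l * (meanLoss ν b - meanLoss ν best
        - 2 / m * excessLoss best x b)) ∂(Measure.pi fun _ => ν) ≤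
      Real.exp (-l * (meanLoss ν b - meanLoss ν best) + 2 * l ^ 2 / m) := by
  have hm0 : (m : ℝ) ≠ 0 := by positivity
  obtain ⟨d, hd⟩ : ∃ d, d = meanLoss ν b - meanLoss ν best := ⟨_, rfl⟩
  have hint : ∀ j, Integrable (fun v : LossVector K => (v j : ℝ)) ν := fun j =>
    Continuous.integrable_of_compactSpace (by fun_prop)
  have hmean : ∫ v : LossVector K, ((v b : ℝ) - v best) ∂ν = d := by
    rw [integral_sub (hint b) (hint best), hd]; rfl
  have hsub := ProbabilityTheory.hasSubgaussianMGF_of_mem_Icc (μ := ν) (a := -1) (b := 1)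
    (X := fun v : LossVector K => (v b : ℝ) - v best) (by fun_prop)
    (Filter.Eventually.of_forall fun v => by
      constructor <;> linarith [(v b).2.1, (v b).2.2, (v best).2.1, (v best).2.2])
  have hmgf := hsub.mgf_le (-(2 * l / m))
  simp only [ProbabilityTheory.mgf, hmean] at hmgf
  have hc : (((‖(1 : ℝ) - -1‖₊ / 2) ^ 2 : NNReal) : ℝ) = 1 := by
    push_cast
    norm_num
  rw [hc, one_mul] at hmgf
  rw [← hd]
  have hprod : ∀ x : Fin m → LossVector K, Real.exp (l * (d - 2 / m * excessLoss best x b)) =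
      Real.exp (-l * d) *
        ∏ s, Real.exp (-(2 * l / m) * (((x s b : ℝ) - x s best) - d)) := by
    intro x
    rw [← Real.exp_sum, ← Real.exp_add, ← Finset.mul_sum, Finset.sum_sub_distrib]
    congr 1
    simp only [excessLoss, Finset.sum_const, Finset.card_univ, Fintype.card_fin, nsmul_eq_mul]
    field_simp
    ring
  simp_rw [hprod]
  rw [integral_const_mul, integral_fintype_prod_eq_pow
    (fun v : LossVector K => Real.exp (-(2 * l / m) * (((v b : ℝ) - v best) - d))),
    Fintype.card_fin, Real.exp_add]
  refine mul_le_mul_of_nonneg_left ?_ (Real.exp_pos _).le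
  calc _ ≤ Real.exp ((-(2 * l / m)) ^ 2 / 2) ^ m :=
        pow_le_pow_left₀ (integral_nonneg fun v => (Real.exp_pos _).le) hmgf m
    _ = _ := by
        rw [← Real.exp_nat_mul]
        congr 1
        field_simp

variable [NeZero K]

theorem continuous_log_partition (η : ℝ) (m : ℕ) : Continuous fun x : Fin m → LossVector K =>
    Real.log (∑ j, Real.exp (-η * excessLoss best x j)) := by
  refine Continuous.log ?_ fun x => (sum_exp_pos _).ne'
  exact continuous_finsetSum _ fun j _ =>
    Real.continuous_exp.comp ((continuous_excessLoss best j).const_mul (-η))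

/-- The be-the-leader inequality for exponential weights. -/
theorem softWeight_mul_last_le (η : ℝ) {n : ℕ} (x : Fin (n + 1) → LossVector K) :
    η * ∑ b, softWeight η (excessLoss best x) b *
        ((x (Fin.last n) b : ℝ) - x (Fin.last n) best) ≤
      Real.log (∑ j, Real.exp (-η * excessLoss best (fun i : Fin n => x i.castSucc) j))
        - Real.log (∑ j, Real.exp (-η * excessLoss best x j)) := by
  have hstep : ∀ j, excessLoss best x j = excessLoss best (fun i : Fin n => x i.castSucc) j
      + ((x (Fin.last n) j : ℝ) - x (Fin.last n) best) := fun j => by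
    simp only [excessLoss, Fin.sum_univ_castSucc]
  have hW := sum_exp_pos fun j => -η * excessLoss best x j
  have hW' := sum_exp_pos fun j => -η * excessLoss best (fun i : Fin n => x i.castSucc) j
  -- After exponentiating, the claim is Jensen's inequality: the old partition function over the new
  -- one is the mean of `exp (η * loss)` under the new weights.
  rw [← Real.log_div hW'.ne' hW.ne', Real.le_log_iff_exp_le (div_pos hW' hW)]
  have hconv := convexOn_exp.map_sum_le (t := Finset.univ)
    (w := fun b => softWeight η (excessLoss best x) b)
    (p := fun b => η * ((x (Fin.last n) b : ℝ) - x (Fin.last n) best))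
    (fun b _ => softWeight_nonneg _ _ _) (sum_softWeight _ _) (fun _ _ => Set.mem_univ _)
  simp only [smul_eq_mul] at hconv
  calc _ = Real.exp (∑ b, softWeight η (excessLoss best x) b *
        (η * ((x (Fin.last n) b : ℝ) - x (Fin.last n) best))) := by
        congr 1
        rw [Finset.mul_sum]
        exact Finset.sum_congr rfl fun b _ => by ring
    _ ≤ _ := hconv
    _ = _ := by
        rw [Finset.sum_div]
        refine Finset.sum_congr rfl fun b _ => ?_
        rw [softWeight, div_mul_eq_mul_div, ← Real.exp_add, hstep b]
        congr 2
        ring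

/-- By exchangeability the average excess loss under the exponential-weights distribution
telescopes. -/
theorem integral_softWeight_mul_excessLoss_le {η : ℝ} (hη : 0 < η) (n : ℕ) :
    ∫ x : Fin (n + 1) → LossVector K, ∑ b, softWeight η (excessLoss best x) b *
        excessLoss best x b ∂(Measure.pi fun _ => ν) ≤
      (n + 1) * ((logPartition η ν best n - logPartition η ν best (n + 1)) / η) := by
  have hw : ∀ b, Continuous fun x : Fin (n + 1) → LossVector K =>
      softWeight η (excessLoss best x) b := fun b =>
    continuous_softWeight η _ (fun j => continuous_excessLoss best j) b
  have hcont : ∀ (s : Fin (n + 1)), Continuous fun x : Fin (n + 1) → LossVector K =>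
      ∑ b, softWeight η (excessLoss best x) b * ((x s b : ℝ) - x s best) := fun s =>
    continuous_finsetSum _ fun b _ => (hw b).mul (by fun_prop)
  have hexch : ∀ s : Fin (n + 1), ∫ x : Fin (n + 1) → LossVector K,
      ∑ b, softWeight η (excessLoss best x) b * ((x s b : ℝ) - x s best)
        ∂(Measure.pi fun _ => ν) = ∫ x : Fin (n + 1) → LossVector K,
      ∑ b, softWeight η (excessLoss best x) b *
        ((x (Fin.last n) b : ℝ) - x (Fin.last n) best) ∂(Measure.pi fun _ => ν) := by
    intro s
    rw [← integral_pi_comp_injective ν (Equiv.swap s (Fin.last n)) (Equiv.injective _)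
      (hcont (Fin.last n)).measurable]
    refine integral_congr_ae (Filter.Eventually.of_forall fun x => ?_)
    have he : excessLoss best (fun i => x (Equiv.swap s (Fin.last n) i)) = excessLoss best x := by
      funext b
      exact Equiv.sum_comp (Equiv.swap s (Fin.last n)) fun i => (x i b : ℝ) - x i best
    simp only [he, Equiv.swap_apply_right]
  have hsum : ∀ x : Fin (n + 1) → LossVector K, ∑ b, softWeight η (excessLoss best x) b *
      excessLoss best x b = ∑ s, ∑ b, softWeight η (excessLoss best x) b *
        ((x s b : ℝ) - x s best) := by
    intro x
    rw [Finset.sum_comm]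
    refine Finset.sum_congr rfl fun b _ => ?_
    rw [← Finset.mul_sum]
    rfl
  simp_rw [hsum]
  rw [integral_finsetSum _ fun s _ => (hcont s).integrable_of_compactSpace,
    Finset.sum_congr rfl fun s _ => hexch s, Finset.sum_const, Finset.card_univ,
    Fintype.card_fin, nsmul_eq_mul]
  push_cast
  refine mul_le_mul_of_nonneg_left ?_ (by positivity)
  rw [le_div_iff₀ hη, mul_comm, ← integral_const_mul]
  have hinit := integral_pi_comp_injective ν (Fin.castSucc : Fin n → Fin (n + 1))
    (Fin.castSucc_injective n) (continuous_log_partition best η n).measurable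
  rw [logPartition, logPartition, ← hinit, ← integral_sub]
  · exact integral_mono ((hcont _).const_mul η).integrable_of_compactSpace
      (((continuous_log_partition best η n).comp (by fun_prop)).sub
        (continuous_log_partition best η (n + 1))).integrable_of_compactSpace
      fun x => softWeight_mul_last_le best η x
  · exact ((continuous_log_partition best η n).comp (by fun_prop)).integrable_of_compactSpace
  · exact (continuous_log_partition best η (n + 1)).integrable_of_compactSpace

theorem hedgeGap_succ_le {η : ℝ} (hη : 0 < η) (n : ℕ) :
    hedgeGap η ν best (n + 1) ≤
      2 * ((logPartition η ν best n - logPartition η ν best (n + 1)) / η)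
        + hedgeDeviation η ν best (n + 1) := by
  have hw : ∀ b, Continuous fun x : Fin (n + 1) → LossVector K =>
      softWeight η (excessLoss best x) b := fun b =>
    continuous_softWeight η _ (fun j => continuous_excessLoss best j) b
  have hD := fun b => continuous_excessLoss (m := n + 1) best b
  have h : hedgeGap η ν best (n + 1) = 2 / (n + 1) * (∫ x : Fin (n + 1) → LossVector K,
      ∑ b, softWeight η (excessLoss best x) b * excessLoss best x b ∂(Measure.pi fun _ => ν))
      + hedgeDeviation η ν best (n + 1) := by
    rw [hedgeGap, hedgeDeviation, ← integral_const_mul, ← integral_add]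
    · refine integral_congr_ae (Filter.Eventually.of_forall fun x => ?_)
      simp only
      rw [Finset.mul_sum, ← Finset.sum_add_distrib]
      refine Finset.sum_congr rfl fun b _ => ?_
      push_cast
      ring
    · refine Continuous.integrable_of_compactSpace (Continuous.const_mul ?_ _)
      exact continuous_finsetSum _ fun b _ => (hw b).mul (hD b)
    · refine Continuous.integrable_of_compactSpace ?_
      exact continuous_finsetSum _ fun b _ => (hw b).mul
        (continuous_const.sub ((hD b).const_mul _))
  rw [h]
  have h2 := mul_le_mul_of_nonneg_left (integral_softWeight_mul_excessLoss_le ν best hη n)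
    (show (0 : ℝ) ≤ 2 / (n + 1) by positivity)
  have h3 : (2 / (n + 1) : ℝ) * ((n + 1) * ((logPartition η ν best n
      - logPartition η ν best (n + 1)) / η)) = 2 * ((logPartition η ν best n
      - logPartition η ν best (n + 1)) / η) := by
    have : (n + 1 : ℝ) ≠ 0 := by positivity
    field_simp
  linarith

/-- A maximal inequality: the weights depend on the sample, and only their being probabilities is
used. The tangent bound `log z ≤ z - 1` is applied to `exp (l y) / c`, with `c` a bound for the
expected sum of exponentials. -/
theorem hedgeDeviation_le (h : ∀ b, 0 ≤ meanLoss ν b - meanLoss ν best) (η : ℝ) {m : ℕ}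
    (hm : 0 < m) {l : ℝ} (hl : 0 < l) :
    hedgeDeviation η ν best m ≤ (Real.log K + 2 * l ^ 2 / m) / l := by
  have hK : (0 : ℝ) < K := by exact_mod_cast NeZero.pos K
  obtain ⟨c, hc⟩ : ∃ c : ℝ, c = K * Real.exp (2 * l ^ 2 / m) := ⟨_, rfl⟩
  have hc0 : 0 < c := by rw [hc]; positivity
  have hlogc : Real.log c = Real.log K + 2 * l ^ 2 / m := by
    rw [hc, Real.log_mul hK.ne' (Real.exp_pos _).ne', Real.log_exp]
  let y : (Fin m → LossVector K) → Fin K → ℝ := fun x b =>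
    meanLoss ν b - meanLoss ν best - 2 / m * excessLoss best x b
  have hy : ∀ b, Continuous fun x => y x b := fun b =>
    continuous_const.sub ((continuous_excessLoss best b).const_mul _)
  have hw : ∀ b, Continuous fun x : Fin m → LossVector K =>
      softWeight η (excessLoss best x) b := fun b =>
    continuous_softWeight η _ (fun j => continuous_excessLoss best j) b
  have hE : ∀ b, Continuous fun x => Real.exp (l * y x b) := fun b =>
    Real.continuous_exp.comp ((hy b).const_mul l)
  have hpt : ∀ x, ∑ b, softWeight η (excessLoss best x) b * y x b ≤
      ((∑ b, Real.exp (l * y x b)) / c - 1 + Real.log c) / l := by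
    intro x
    rw [le_div_iff₀ hl, Finset.sum_mul]
    calc ∑ b, softWeight η (excessLoss best x) b * y x b * l
        ≤ ∑ b, (Real.exp (l * y x b) / c
            + softWeight η (excessLoss best x) b * (-1 + Real.log c)) := by
          refine Finset.sum_le_sum fun b _ => ?_
          have h1 := Real.log_le_sub_one_of_pos (div_pos (Real.exp_pos (l * y x b)) hc0)
          rw [Real.log_div (Real.exp_pos _).ne' hc0.ne', Real.log_exp] at h1
          have h2 := softWeight_nonneg η (excessLoss best x) b
          have h3 := mul_le_mul_of_nonneg_left h1 h2
          have h4 : softWeight η (excessLoss best x) b * (Real.exp (l * y x b) / c) ≤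
              Real.exp (l * y x b) / c :=
            mul_le_of_le_one_left (by positivity) (softWeight_le_one _ _ _)
          linarith
      _ = _ := by
          rw [Finset.sum_add_distrib, ← Finset.sum_mul, sum_softWeight, ← Finset.sum_div]
          ring
  have hI : ∫ x, ∑ b, softWeight η (excessLoss best x) b * y x b ∂(Measure.pi fun _ => ν) ≤
      ∫ x, ((∑ b, Real.exp (l * y x b)) / c - 1 + Real.log c) / l
        ∂(Measure.pi fun _ : Fin m => ν) := integral_mono
    (Continuous.integrable_of_compactSpace
      (continuous_finsetSum _ fun b _ => (hw b).mul (hy b)))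
    (Continuous.integrable_of_compactSpace (((((continuous_finsetSum Finset.univ fun b _ =>
      hE b).div_const c).sub continuous_const).add continuous_const).div_const l)) hpt
  refine hI.trans ?_
  have hS : Integrable (fun x => (∑ b, Real.exp (l * y x b)) / c)
      (Measure.pi fun _ : Fin m => ν) := Continuous.integrable_of_compactSpace
    ((continuous_finsetSum Finset.univ fun b _ => hE b).div_const c)
  have hS1 : Integrable (fun x => (∑ b, Real.exp (l * y x b)) / c - 1)
      (Measure.pi fun _ : Fin m => ν) := hS.sub (integrable_const _)
  rw [integral_div, integral_add hS1 (integrable_const _),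
    integral_sub hS (integrable_const _), integral_div, integral_finsetSum _
      fun b _ => (hE b).integrable_of_compactSpace, ← hlogc]
  simp only [integral_const, probReal_univ, one_smul]
  have hle : (∑ b, ∫ x, Real.exp (l * y x b) ∂(Measure.pi fun _ : Fin m => ν)) / c ≤ 1 := by
    rw [div_le_one hc0, hc]
    calc _ ≤ ∑ b : Fin K, Real.exp (2 * l ^ 2 / m) := by
          refine Finset.sum_le_sum fun b _ =>
            (integral_exp_deviation_le ν best hm l b).trans (Real.exp_le_exp.2 ?_)
          have := mul_nonneg hl.le (h b)
          linarith
      _ = _ := by simp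
  gcongr
  linarith

theorem hedgeDeviation_le_exp {Δ : ℝ} (hΔ : 0 < Δ)
    (h : ∀ b, b ≠ best → Δ ≤ meanLoss ν b - meanLoss ν best) (η : ℝ) {m : ℕ} (hm : 0 < m) :
    hedgeDeviation η ν best m ≤ 4 / (m * Δ) * (K * Real.exp (-(m * Δ ^ 2 / 8))) := by
  have hm0 : (0 : ℝ) < m := by positivity
  -- This minimises the exponent `-lΔ + 2l²/m`, with value `-mΔ²/8`.
  obtain ⟨l, hl⟩ : ∃ l : ℝ, l = m * Δ / 4 := ⟨_, rfl⟩
  have hl0 : 0 < l := by rw [hl]; positivity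
  let y : (Fin m → LossVector K) → Fin K → ℝ := fun x b =>
    meanLoss ν b - meanLoss ν best - 2 / m * excessLoss best x b
  have hy : ∀ b, Continuous fun x => y x b := fun b =>
    continuous_const.sub ((continuous_excessLoss best b).const_mul _)
  have hw : ∀ b, Continuous fun x : Fin m → LossVector K =>
      softWeight η (excessLoss best x) b := fun b =>
    continuous_softWeight η _ (fun j => continuous_excessLoss best j) b
  have hE : ∀ b, Continuous fun x => Real.exp (l * y x b) := fun b =>
    Real.continuous_exp.comp ((hy b).const_mul l)
  have hpt : ∀ x, ∑ b, softWeight η (excessLoss best x) b * y x b ≤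
      1 / l * ∑ b ∈ Finset.univ.erase best, Real.exp (l * y x b) := by
    intro x
    have hb : y x best = 0 := by simp [y, excessLoss_best]
    rw [← Finset.add_sum_erase _ _ (Finset.mem_univ best), hb, mul_zero, zero_add,
      Finset.mul_sum]
    refine Finset.sum_le_sum fun b _ => ?_
    have h1 : y x b ≤ 1 / l * Real.exp (l * y x b) := by
      rw [one_div, ← div_eq_inv_mul, le_div_iff₀ hl0]
      linarith [Real.add_one_le_exp (l * y x b)]
    have h2 : 0 ≤ 1 / l * Real.exp (l * y x b) := by positivity
    calc _ ≤ softWeight η (excessLoss best x) b * (1 / l * Real.exp (l * y x b)) :=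
          mul_le_mul_of_nonneg_left h1 (softWeight_nonneg _ _ _)
      _ ≤ _ := mul_le_of_le_one_left h2 (softWeight_le_one _ _ _)
  have hI : ∫ x, ∑ b, softWeight η (excessLoss best x) b * y x b ∂(Measure.pi fun _ => ν) ≤
      ∫ x, 1 / l * ∑ b ∈ Finset.univ.erase best, Real.exp (l * y x b)
        ∂(Measure.pi fun _ : Fin m => ν) := integral_mono
    (Continuous.integrable_of_compactSpace
      (continuous_finsetSum _ fun b _ => (hw b).mul (hy b)))
    (Continuous.integrable_of_compactSpace ((continuous_finsetSum (Finset.univ.erase best)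
      fun b _ => hE b).const_mul (1 / l))) hpt
  refine hI.trans ?_
  rw [integral_const_mul, integral_finsetSum _ fun b _ => (hE b).integrable_of_compactSpace,
    show 1 / l = 4 / (m * Δ) by rw [hl]; field_simp]
  refine mul_le_mul_of_nonneg_left ?_ (by positivity)
  calc _ ≤ ∑ b ∈ Finset.univ.erase best, Real.exp (-(m * Δ ^ 2 / 8)) := by
        refine Finset.sum_le_sum fun b hb =>
          (integral_exp_deviation_le ν best hm l b).trans (Real.exp_le_exp.2 ?_)
        have h1 := mul_le_mul_of_nonneg_left (h b (Finset.ne_of_mem_erase hb)) hl0.le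
        have h2 : 2 * l ^ 2 / m = m * Δ ^ 2 / 8 := by rw [hl]; field_simp; norm_num
        have h3 : l * Δ = m * Δ ^ 2 / 4 := by rw [hl]; ring
        linarith
    _ ≤ ∑ b : Fin K, Real.exp (-(m * Δ ^ 2 / 8)) :=
        Finset.sum_le_sum_of_subset_of_nonneg (Finset.erase_subset _ _)
          fun _ _ _ => (Real.exp_pos _).le
    _ = _ := by simp

theorem one_div_sqrt_succ_le (k : ℕ) :
    1 / Real.sqrt (k + 1) ≤ 2 * (Real.sqrt (k + 1) - Real.sqrt k) := by
  have h1 : 0 < Real.sqrt (k + 1) := Real.sqrt_pos.2 (by positivity)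
  have h2 : Real.sqrt (k + 1) ^ 2 = k + 1 := Real.sq_sqrt (by positivity)
  have h3 : Real.sqrt k ^ 2 = k := Real.sq_sqrt (by positivity)
  rw [div_le_iff₀ h1]
  nlinarith [sq_nonneg (Real.sqrt (k + 1) - Real.sqrt k)]

theorem sum_hedgeDeviation_le (hK : 2 ≤ K) {Δ : ℝ} (hΔ : 0 < Δ)
    (h : ∀ b, b ≠ best → Δ ≤ meanLoss ν b - meanLoss ν best) (η : ℝ) (n : ℕ) :
    ∑ k ∈ Finset.range n, hedgeDeviation η ν best (k + 1) ≤ 33 * (Real.log K / Δ) := by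
  have hlog2 : 0.69 ≤ Real.log K := by
    have := Real.log_le_log (by norm_num) (show (2 : ℝ) ≤ K by exact_mod_cast hK)
    linarith [Real.log_two_gt_d9]
  have hlogK : 0 < Real.log K := by linarith
  have hnn : ∀ b, 0 ≤ meanLoss ν b - meanLoss ν best := by
    intro b
    by_cases hb : b = best
    · rw [hb, sub_self]
    · exact hΔ.le.trans (h b hb)
  -- Beyond `N` the factor `K` is absorbed by half of the exponential decay, since `N * a = log K`
  -- for `a = Δ² / 16`.
  obtain ⟨N, hN⟩ : ∃ N : ℝ, N = 16 * Real.log K / Δ ^ 2 := ⟨_, rfl⟩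
  have hN0 : 0 < N := by rw [hN]; positivity
  obtain ⟨a, ha⟩ : ∃ a : ℝ, a = Δ ^ 2 / 16 := ⟨_, rfl⟩
  have ha0 : 0 < a := by rw [ha]; positivity
  -- A potential whose increments dominate the deviations: the first part integrates `3 √(log K /
  -- m)` and freezes at `N`, the second integrates the exponential tail.
  let f : ℕ → ℝ := fun k => 3 * Real.sqrt (Real.log K) * (2 * Real.sqrt (min k N))
    - Δ / (4 * Real.log K) * (Real.exp (-(k * a)) / a)
  have hterm : ∀ k : ℕ, hedgeDeviation η ν best (k + 1) ≤ f (k + 1) - f k := by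
    intro k
    have hk0 : (0 : ℝ) < k + 1 := by positivity
    have hexp : Real.exp (-((k + 1) * a)) ≤
        Real.exp (-(k * a)) / a - Real.exp (-((k + 1) * a)) / a := by
      rw [← sub_div, le_div_iff₀ ha0, show -(k * a) = -((k + 1) * a) + a by ring, Real.exp_add]
      have := mul_le_mul_of_nonneg_left (Real.add_one_le_exp a)
        (Real.exp_pos (-((k + 1) * a))).le
      linarith
    have hexp' := mul_le_mul_of_nonneg_left hexp
      (show 0 ≤ Δ / (4 * Real.log K) by positivity)
    have hexp0 : 0 ≤ Δ / (4 * Real.log K) * Real.exp (-((k + 1) * a)) := by positivity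
    have hmono : Real.sqrt (min k N) ≤ Real.sqrt (min (k + 1) N) :=
      Real.sqrt_le_sqrt (min_le_min (by linarith) le_rfl)
    have hmono' := mul_le_mul_of_nonneg_left hmono
      (show 0 ≤ 3 * Real.sqrt (Real.log K) by positivity)
    simp only [f]
    push_cast
    by_cases hkN : (k + 1 : ℝ) ≤ N
    · have hl : 0 < Real.sqrt ((k + 1) * Real.log K) := Real.sqrt_pos.2 (by positivity)
      have h1 := hedgeDeviation_le ν best hnn η (Nat.succ_pos k) hl
      rw [Real.sq_sqrt (by positivity)] at h1
      push_cast at h1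
      have hs1 : 0 < Real.sqrt (k + 1) := Real.sqrt_pos.2 hk0
      have hs2 : 0 < Real.sqrt (Real.log K) := Real.sqrt_pos.2 hlogK
      have h2 : (Real.log K + 2 * ((k + 1) * Real.log K) / (k + 1)) /
          Real.sqrt ((k + 1) * Real.log K) =
          3 * Real.sqrt (Real.log K) * (1 / Real.sqrt (k + 1)) := by
        rw [Real.sqrt_mul hk0.le]
        field_simp
        rw [Real.sq_sqrt hlogK.le]
        ring
      have h3 := mul_le_mul_of_nonneg_left (one_div_sqrt_succ_le k)
        (show 0 ≤ 3 * Real.sqrt (Real.log K) by positivity)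
      rw [min_eq_left hkN, min_eq_left (by linarith)]
      simp only [Nat.succ_eq_add_one] at h1
      linarith
    · have hkN' : N < k + 1 := not_le.1 hkN
      have h1 := hedgeDeviation_le_exp ν best hΔ h η (Nat.succ_pos k)
      push_cast at h1
      have h2 : (K : ℝ) * Real.exp (-((k + 1) * Δ ^ 2 / 8)) ≤ Real.exp (-((k + 1) * a)) := by
        have hKe : (K : ℝ) = Real.exp (Real.log K) := (Real.exp_log (by positivity)).symm
        rw [hKe, ← Real.exp_add]
        refine Real.exp_le_exp.2 ?_
        have h3 : Real.log K = N * a := by rw [hN, ha]; field_simp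
        have h4 : N * a ≤ (k + 1) * a := by gcongr
        have h5 : (k + 1 : ℝ) * Δ ^ 2 / 8 = 2 * ((k + 1) * a) := by rw [ha]; ring
        linarith
      have h3 : 4 / ((k + 1 : ℝ) * Δ) ≤ Δ / (4 * Real.log K) := by
        calc 4 / ((k + 1 : ℝ) * Δ) ≤ 4 / (N * Δ) := by gcongr
          _ = Δ / (4 * Real.log K) := by rw [hN]; field_simp; norm_num
      have h4 : 4 / ((k + 1 : ℝ) * Δ) * (K * Real.exp (-((k + 1) * Δ ^ 2 / 8))) ≤
          Δ / (4 * Real.log K) * Real.exp (-((k + 1) * a)) :=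
        mul_le_mul h3 h2 (by positivity) (by positivity)
      simp only [Nat.succ_eq_add_one] at h1
      linarith
  calc ∑ k ∈ Finset.range n, hedgeDeviation η ν best (k + 1)
      ≤ ∑ k ∈ Finset.range n, (f (k + 1) - f k) := Finset.sum_le_sum fun k _ => hterm k
    _ = f n - f 0 := Finset.sum_range_sub f n
    _ ≤ 3 * Real.sqrt (Real.log K) * (2 * Real.sqrt N) + Δ / (4 * Real.log K) * (1 / a) := by
        have h1 : Real.sqrt (min n N) ≤ Real.sqrt N := Real.sqrt_le_sqrt (min_le_right _ _)
        have h2 := mul_le_mul_of_nonneg_left h1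
          (show 0 ≤ 3 * Real.sqrt (Real.log K) by positivity)
        have h3 : 0 ≤ Δ / (4 * Real.log K) * (Real.exp (-(n * a)) / a) := by positivity
        have h4 : min 0 N = 0 := min_eq_left hN0.le
        simp only [f, Nat.cast_zero, h4, Real.sqrt_zero, zero_mul, neg_zero, Real.exp_zero]
        linarith
    _ = 24 * (Real.log K / Δ) + 4 / (Real.log K * Δ) := by
        rw [hN, Real.sqrt_div (by positivity), Real.sqrt_mul (by norm_num), Real.sqrt_sq hΔ.le,
          show Real.sqrt 16 = 4 by
            rw [show (16 : ℝ) = 4 ^ 2 by norm_num]; exact Real.sqrt_sq (by norm_num), ha]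
        have h1 : Real.sqrt (Real.log K) * Real.sqrt (Real.log K) = Real.log K :=
          Real.mul_self_sqrt hlogK.le
        have h2 : 3 * Real.sqrt (Real.log K) * (2 * (4 * Real.sqrt (Real.log K) / Δ)) =
            24 * (Real.sqrt (Real.log K) * Real.sqrt (Real.log K) / Δ) := by ring
        rw [h2, h1]
        congr 1
        field_simp
        norm_num
    _ ≤ _ := by
        have h1 : 4 / (Real.log K * Δ) ≤ 9 * (Real.log K / Δ) := by
          rw [mul_div_assoc', div_le_div_iff₀ (by positivity) hΔ]
          have h2 : 4 ≤ 9 * (Real.log K * Real.log K) := by nlinarith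
          have h3 := mul_le_mul_of_nonneg_right h2 hΔ.le
          linarith
        linarith

/-- The regret of exponential weights with a constant learning rate on i.i.d. losses, over any
horizon. -/
theorem sum_hedgeGap_le (hK : 2 ≤ K) {Δ : ℝ} (hΔ : 0 < Δ)
    (h : ∀ b, b ≠ best → Δ ≤ meanLoss ν b - meanLoss ν best) {η : ℝ} (hη : 0 < η) (n : ℕ) :
    ∑ k ∈ Finset.range n, hedgeGap η ν best (k + 1) ≤
      2 * (Real.log K / η) + 33 * (Real.log K / Δ) := by
  have h1 : ∑ k ∈ Finset.range n, (2 * ((logPartition η ν best k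
      - logPartition η ν best (k + 1)) / η)) ≤ 2 * (Real.log K / η) := by
    rw [← Finset.mul_sum, ← Finset.sum_div, Finset.sum_range_sub', logPartition_zero]
    have := logPartition_nonneg ν best η n
    gcongr
    linarith
  calc _ ≤ ∑ k ∈ Finset.range n, (2 * ((logPartition η ν best k
        - logPartition η ν best (k + 1)) / η) + hedgeDeviation η ν best (k + 1)) :=
        Finset.sum_le_sum fun k _ => hedgeGap_succ_le ν best hη k
    _ ≤ _ := by
        rw [Finset.sum_add_distrib]
        exact add_le_add h1 (sum_hedgeDeviation_le ν best hK hΔ h η n)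

end Hedge

/-! ### From blocks to the regret of exponential weights. -/

section UpperBound

variable {K : ℕ}

theorem prefixLengthPMF_bind_toReal (r : ℕ) (f : ℕ → PMF (Fin K)) (b : Fin K) :
    ((prefixLengthPMF r).bind f b).toReal = ∑ m ∈ Finset.Ioc (2 ^ r / 2) (2 ^ r),
      ((2 ^ r - 2 ^ r / 2 : ℕ) : ℝ)⁻¹ * (f m b).toReal := by
  rw [PMF.bind_apply, tsum_eq_sum (s := Finset.Ioc (2 ^ r / 2) (2 ^ r)), ENNReal.toReal_sum]
  · refine Finset.sum_congr rfl fun m hm => ?_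
    rw [ENNReal.toReal_mul, prefixLengthPMF, PMF.uniformOfFinset_apply_of_mem _ hm,
      ENNReal.toReal_inv, Nat.card_Ioc, ENNReal.toReal_natCast]
  · intro m _
    exact ENNReal.mul_ne_top ((prefixLengthPMF r).apply_ne_top m) ((f m).apply_ne_top b)
  · intro m hm
    rw [prefixLengthPMF, PMF.uniformOfFinset_apply_of_notMem _ hm, zero_mul]

theorem blockPrefixLoss_castSucc {t : ℕ} (x : Fin (t + 1) → LossVector K) {r m : ℕ}
    (h : 2 ^ r + m ≤ t + 1) :
    blockPrefixLoss (fun i : Fin t => x i.castSucc) r m = blockPrefixLoss x r m := by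
  funext j
  unfold blockPrefixLoss
  rw [Fin.sum_univ_castSucc, if_neg, add_zero]
  · rfl
  · simp only [Fin.val_last]
    omega

theorem OnlineAlgorithm.nextLaw_succ_of_repeat (alg : OnlineAlgorithm K) (t : ℕ)
    (x : Fin (t + 1) → LossVector K)
    (h : ∀ a, alg.policy (t + 1) x a = PMF.pure (a (Fin.last t))) :
    alg.nextLaw (t + 1) x = alg.nextLaw t fun i => x i.castSucc := by
  have hp : alg.policy (t + 1) x = fun a => PMF.pure (a (Fin.last t)) := funext h
  rw [nextLaw, hp, law, PMF.bind_bind, nextLaw]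
  congr 1
  funext a
  rw [PMF.bind_map]
  have : ((fun a : Fin (t + 1) → Fin K => PMF.pure (a (Fin.last t))) ∘
      fun b => (Fin.snoc a b : Fin (t + 1) → Fin K)) = PMF.pure := by
    funext b
    simp
  rw [this, PMF.bind_pure]

/-- Prefixes of a block have the same law as prefixes of the whole sequence. -/
theorem integral_softWeight_blockPrefixLoss [NeZero K] (ν : Measure (LossVector K))
    [IsProbabilityMeasure ν] (best : Fin K) (η : ℝ) {t r m : ℕ} (h : 2 ^ r + m ≤ t + 1)
    (b : Fin K) :
    ∫ x : Fin t → LossVector K, softWeight η (blockPrefixLoss x r m) b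
        ∂(Measure.pi fun _ => ν) =
      ∫ x : Fin m → LossVector K, softWeight η (excessLoss best x) b
        ∂(Measure.pi fun _ => ν) := by
  have h2 : 1 ≤ 2 ^ r := Nat.one_le_two_pow
  let e : Fin m → Fin t := fun s => ⟨2 ^ r - 1 + s, by have := s.2; omega⟩
  have he : Function.Injective e := by
    intro s s' hs
    have := congrArg Fin.val hs
    simp only [e] at this
    exact Fin.ext (by omega)
  have hL : ∀ x : Fin t → LossVector K,
      (blockPrefixLoss x r m) = fun j => ∑ s, (x (e s) j : ℝ) := by
    intro x
    funext j
    unfold blockPrefixLoss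
    rw [← Finset.sum_filter, ← Finset.sum_image (s := Finset.univ) (g := e)
      (f := fun i => (x i j : ℝ)) (fun _ _ _ _ h => he h)]
    refine Finset.sum_congr ?_ fun _ _ => rfl
    ext i
    simp only [Finset.mem_filter, Finset.mem_univ, true_and, Finset.mem_image, e]
    constructor
    · intro hi
      refine ⟨⟨(i : ℕ) - (2 ^ r - 1), by omega⟩, Fin.ext ?_⟩
      simp only
      omega
    · rintro ⟨s, rfl⟩
      have := s.2
      simp only
      omega
  have hex : ∀ (x : Fin m → LossVector K), softWeight η (fun j => ∑ s, (x s j : ℝ)) b =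
      softWeight η (excessLoss best x) b := by
    intro x
    rw [← softWeight_sub_const η _ (∑ s, (x s best : ℝ))]
    congr 1
    funext j
    rw [excessLoss, Finset.sum_sub_distrib]
  simp_rw [hL]
  rw [integral_pi_comp_injective ν e he
    (f := fun x : Fin m → LossVector K => softWeight η (fun j => ∑ s, (x s j : ℝ)) b)
    (continuous_softWeight η _ (fun j => by fun_prop) b).measurable]
  simp_rw [hex]

variable [NeZero K]

/-- Induction on the round: inside a block the action is repeated, and the newest loss vector lies
beyond every prefix of the preceding block. -/
theorem nextLaw_randomizedPrefixSoftmax (ε : ℝ) (p₀ : PMF (Fin K)) {t : ℕ} (ht : 1 ≤ t) :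
    ∀ (x : Fin t → LossVector K) (b : Fin K),
    ((randomizedPrefixSoftmax ε p₀).nextLaw t x b).toReal =
      (((prefixLengthPMF (Nat.log 2 (t + 1) - 1)).bind fun m =>
        softmaxPMF (min (ε / 2) (1 / 8))
          (blockPrefixLoss x (Nat.log 2 (t + 1) - 1) m)) b).toReal := by
  have hboundary : ∀ t, 1 ≤ t → t + 1 = 2 ^ Nat.log 2 (t + 1) →
      ∀ (x : Fin t → LossVector K),
      (randomizedPrefixSoftmax ε p₀).nextLaw t x =
      ((prefixLengthPMF (Nat.log 2 (t + 1) - 1)).bind fun m =>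
        softmaxPMF (min (ε / 2) (1 / 8)) (blockPrefixLoss x (Nat.log 2 (t + 1) - 1) m)) := by
    intro t ht hb x
    have hp : ∀ a, (randomizedPrefixSoftmax ε p₀).policy t x a =
        ((prefixLengthPMF (Nat.log 2 (t + 1) - 1)).bind fun m =>
        softmaxPMF (min (ε / 2) (1 / 8)) (blockPrefixLoss x (Nat.log 2 (t + 1) - 1) m)) := by
      intro a
      simp only [randomizedPrefixSoftmax, randomizedPrefixPolicy]
      rw [dif_neg (by omega), if_pos hb]
    rw [OnlineAlgorithm.nextLaw, funext hp, PMF.bind_const]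
  induction t, ht using Nat.le_induction with
  | base =>
    intro x b
    have hlog : Nat.log 2 (1 + 1) = 1 :=
      (Nat.log_eq_iff (Or.inr ⟨by norm_num, by norm_num⟩)).2 ⟨by norm_num, by norm_num⟩
    rw [hboundary 1 le_rfl (by rw [hlog]; rfl)]
  | succ t ht ih =>
    intro x b
    by_cases hb : t + 1 + 1 = 2 ^ Nat.log 2 (t + 1 + 1)
    · rw [hboundary (t + 1) (by omega) hb]
    · have hrep := (randomizedPrefixSoftmax ε p₀).nextLaw_succ_of_repeat t x (by
        intro a
        simp only [randomizedPrefixSoftmax, randomizedPrefixPolicy]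
        rw [dif_neg (by omega), if_neg hb]
        rfl)
      have hle : 2 ^ Nat.log 2 (t + 1 + 1) ≤ t + 1 + 1 := Nat.pow_log_le_self 2 (by omega)
      have hlt : t + 1 + 1 < 2 ^ (Nat.log 2 (t + 1 + 1) + 1) :=
        Nat.lt_pow_succ_log_self (by norm_num) _
      have hlog : Nat.log 2 (t + 1) = Nat.log 2 (t + 1 + 1) := by
        rw [Nat.log_eq_iff (Or.inr ⟨by norm_num, by omega⟩)]
        omega
      have h1 : 1 ≤ Nat.log 2 (t + 1) := Nat.log_pos (by norm_num) (by omega)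
      obtain ⟨r, hr⟩ := Nat.exists_eq_add_of_le' h1
      rw [hrep, ih, hlog, prefixLengthPMF_bind_toReal, prefixLengthPMF_bind_toReal]
      refine Finset.sum_congr rfl fun m hm => ?_
      have hle' : 2 ^ Nat.log 2 (t + 1) ≤ t + 1 := Nat.pow_log_le_self 2 (by omega)
      rw [← hlog, hr] at hm
      rw [hr, pow_succ] at hle'
      rw [← hlog, hr, blockPrefixLoss_castSucc]
      have := (Finset.mem_Ioc.1 hm).2
      simp only [Nat.add_sub_cancel] at this ⊢
      omega

/-- The expected gap of the action played in a round of block `r + 1`. -/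
theorem sum_gap_mul_integral_nextLaw (ν : Measure (LossVector K)) [IsProbabilityMeasure ν]
    (best : Fin K) (ε : ℝ) (p₀ : PMF (Fin K)) {t r : ℕ} (h1 : 2 ^ (r + 1) ≤ t + 1)
    (h2 : t + 1 < 2 ^ (r + 2)) :
    ∑ b, (meanLoss ν b - meanLoss ν best) *
      ∫ x, ((randomizedPrefixSoftmax ε p₀).nextLaw t x b).toReal ∂(Measure.pi fun _ => ν) =
    ((2 ^ r - 2 ^ r / 2 : ℕ) : ℝ)⁻¹ * ∑ m ∈ Finset.Ioc (2 ^ r / 2) (2 ^ r),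
      hedgeGap (min (ε / 2) (1 / 8)) ν best m := by
  have hr : 1 ≤ 2 ^ r := Nat.one_le_two_pow
  have hlog : Nat.log 2 (t + 1) = r + 1 := by
    rw [Nat.log_eq_iff (Or.inr ⟨by norm_num, by omega⟩)]
    exact ⟨h1, h2⟩
  have ht : 1 ≤ t := by rw [pow_succ] at h1; omega
  have hcont : ∀ m b, Continuous fun x : Fin t → LossVector K =>
      softWeight (min (ε / 2) (1 / 8)) (blockPrefixLoss x r m) b := by
    intro m b
    refine continuous_softWeight _ _ (fun j => ?_) b
    unfold blockPrefixLoss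
    refine continuous_finsetSum _ fun i _ => ?_
    split_ifs <;> fun_prop
  have hint : ∀ b,
      ∫ x, ((randomizedPrefixSoftmax ε p₀).nextLaw t x b).toReal ∂(Measure.pi fun _ => ν) =
      ∑ m ∈ Finset.Ioc (2 ^ r / 2) (2 ^ r), ((2 ^ r - 2 ^ r / 2 : ℕ) : ℝ)⁻¹ *
        ∫ x : Fin m → LossVector K, softWeight (min (ε / 2) (1 / 8)) (excessLoss best x) b
          ∂(Measure.pi fun _ => ν) := by
    intro b
    simp only [nextLaw_randomizedPrefixSoftmax ε p₀ ht, hlog, Nat.add_sub_cancel,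
      prefixLengthPMF_bind_toReal, softmaxPMF_toReal]
    rw [integral_finsetSum _ fun m _ =>
      ((hcont m b).const_mul _).integrable_of_compactSpace]
    refine Finset.sum_congr rfl fun m hm => ?_
    rw [integral_const_mul, integral_softWeight_blockPrefixLoss ν best]
    have := (Finset.mem_Ioc.1 hm).2
    rw [pow_succ] at h1
    omega
  have hgap : ∀ m, hedgeGap (min (ε / 2) (1 / 8)) ν best m =
      ∑ b, (meanLoss ν b - meanLoss ν best) * ∫ x : Fin m → LossVector K,
        softWeight (min (ε / 2) (1 / 8)) (excessLoss best x) b ∂(Measure.pi fun _ => ν) := by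
    intro m
    rw [hedgeGap, integral_finsetSum]
    · refine Finset.sum_congr rfl fun b _ => ?_
      rw [integral_mul_const, mul_comm]
    · intro b _
      exact ((continuous_softWeight _ _ (fun j => continuous_excessLoss best j)
        b).integrable_of_compactSpace).mul_const _
  simp_rw [hint, hgap, Finset.mul_sum]
  rw [Finset.sum_comm]
  refine Finset.sum_congr rfl fun m _ => Finset.sum_congr rfl fun b _ => ?_
  ring

theorem regret_randomizedPrefixSoftmax_le (hK : 2 ≤ K) {ε : ℝ} (hε : 0 < ε) (p₀ : PMF (Fin K))
    (ν : Measure (LossVector K)) [IsProbabilityMeasure ν] (best : Fin K) {Δ : ℝ}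
    (hgap : HasMinGap ν best Δ) (T : ℕ) :
    (randomizedPrefixSoftmax ε p₀).regret ν best T
      ≤ 1000 * (Real.log K / Δ + Real.log K / ε) := by
  obtain ⟨hΔ, ⟨j₀, -, hj₀⟩, hleast⟩ := hgap
  have h : ∀ b, b ≠ best → Δ ≤ meanLoss ν b - meanLoss ν best := fun b hb =>
    hleast ⟨b, hb, rfl⟩
  have hnn : ∀ b, 0 ≤ meanLoss ν b - meanLoss ν best := by
    intro b
    by_cases hb : b = best
    · rw [hb, sub_self]
    · exact hΔ.le.trans (h b hb)
  have hmean : ∀ b, 0 ≤ meanLoss ν b ∧ meanLoss ν b ≤ 1 := by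
    intro b
    refine ⟨integral_nonneg fun v => (v b).2.1, ?_⟩
    calc meanLoss ν b ≤ ∫ _, (1 : ℝ) ∂ν := integral_mono
          (Continuous.integrable_of_compactSpace (by fun_prop)) (integrable_const _)
          fun v => (v b).2.2
      _ = 1 := by simp
  have hle1 : ∀ b, meanLoss ν b - meanLoss ν best ≤ 1 := fun b => by
    linarith [(hmean b).2, (hmean best).1]
  have hΔ1 : Δ ≤ 1 := hj₀ ▸ hle1 j₀
  obtain ⟨η, hη⟩ : ∃ η, η = min (ε / 2) (1 / 8) := ⟨_, rfl⟩
  have hη0 : 0 < η := by rw [hη]; exact lt_min (by positivity) (by norm_num)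
  obtain ⟨c, hc⟩ : ∃ c : ℕ → ℝ, c = fun t => ∑ b, (meanLoss ν b - meanLoss ν best) *
      ∫ x, ((randomizedPrefixSoftmax ε p₀).nextLaw t x b).toReal ∂(Measure.pi fun _ => ν) :=
    ⟨_, rfl⟩
  have hc0 : ∀ t, 0 ≤ c t := fun t => by
    rw [hc]
    exact Finset.sum_nonneg fun b _ =>
      mul_nonneg (hnn b) (integral_nonneg fun x => ENNReal.toReal_nonneg)
  have hcle : ∀ t, c t ≤ 1 := fun t => by
    rw [hc, ← (randomizedPrefixSoftmax ε p₀).sum_integral_nextLaw t (Measure.pi fun _ => ν)]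
    exact Finset.sum_le_sum fun b _ => mul_le_of_le_one_left
      (integral_nonneg fun x => ENNReal.toReal_nonneg) (hle1 b)
  have hg0 : ∀ m, 0 ≤ hedgeGap η ν best m := fun m => integral_nonneg fun x =>
    Finset.sum_nonneg fun b _ => mul_nonneg (softWeight_nonneg _ _ _) (hnn b)
  -- Blocks `0` to `R` cost at most `1` for block `0`, plus prefix lengths up to `2 ^ R / 2`: the
  -- ranges used by consecutive blocks are adjacent, so no `m` is counted twice.
  have hblock : ∀ R : ℕ, ∑ t ∈ Finset.range (2 ^ (R + 1) - 1), c t ≤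
      1 + 4 * ∑ m ∈ Finset.Ioc 0 (2 ^ R / 2), hedgeGap η ν best m := by
    intro R
    induction R with
    | zero => simpa using hcle 0
    | succ r ih =>
      have hp : 1 ≤ 2 ^ r := Nat.one_le_two_pow
      have e1 : 2 ^ (r + 1) = 2 * 2 ^ r := by ring
      have e2 : 2 ^ (r + 1 + 1) = 4 * 2 ^ r := by ring
      have hsplit : 2 ^ (r + 1 + 1) - 1 = (2 ^ (r + 1) - 1) + 2 ^ (r + 1) := by omega
      rw [hsplit, Finset.sum_range_add,
        show 2 ^ (r + 1) / 2 = 2 ^ r by omega,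
        ← Finset.Ioc_union_Ioc_eq_Ioc (Nat.zero_le (2 ^ r / 2)) (by omega : 2 ^ r / 2 ≤ 2 ^ r),
        Finset.sum_union (Finset.Ioc_disjoint_Ioc_of_le le_rfl)]
      have hin : ∑ s ∈ Finset.range (2 ^ (r + 1)), c (2 ^ (r + 1) - 1 + s) ≤
          4 * ∑ m ∈ Finset.Ioc (2 ^ r / 2) (2 ^ r), hedgeGap η ν best m := by
        have hS : 0 ≤ ∑ m ∈ Finset.Ioc (2 ^ r / 2) (2 ^ r), hedgeGap η ν best m :=
          Finset.sum_nonneg fun m _ => hg0 m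
        have hterm : ∀ s ∈ Finset.range (2 ^ (r + 1)), c (2 ^ (r + 1) - 1 + s) =
            ((2 ^ r - 2 ^ r / 2 : ℕ) : ℝ)⁻¹ * ∑ m ∈ Finset.Ioc (2 ^ r / 2) (2 ^ r),
              hedgeGap η ν best m := by
          intro s hs
          have := Finset.mem_range.1 hs
          rw [hc, hη]
          have e3 : 2 ^ (r + 2) = 4 * 2 ^ r := by ring
          exact sum_gap_mul_integral_nextLaw ν best ε p₀ (by omega) (by omega)
        rw [Finset.sum_congr rfl hterm, Finset.sum_const, Finset.card_range, nsmul_eq_mul,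
          ← mul_assoc]
        refine mul_le_mul_of_nonneg_right ?_ hS
        have hq : 0 < 2 ^ r - 2 ^ r / 2 := by omega
        have hq' : (0 : ℝ) < ((2 ^ r - 2 ^ r / 2 : ℕ) : ℝ) := by exact_mod_cast hq
        rw [← div_eq_mul_inv, div_le_iff₀ hq']
        -- Block length against number of prefix lengths: equality for `r ≥ 1`, and `2 ≤ 4` for `r =
        -- 0`.
        have : 2 ^ (r + 1) ≤ 4 * (2 ^ r - 2 ^ r / 2) := by omega
        exact_mod_cast this
      linarith
  have hlogK : 0.69 ≤ Real.log K := by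
    have := Real.log_le_log (by norm_num) (show (2 : ℝ) ≤ K by exact_mod_cast hK)
    linarith [Real.log_two_gt_d9]
  have hTle : T ≤ 2 ^ (T + 1) - 1 := by
    have : T + 1 < 2 ^ (T + 1) := Nat.lt_two_pow_self
    omega
  have hIoc : ∑ m ∈ Finset.Ioc 0 (2 ^ T / 2), hedgeGap η ν best m =
      ∑ k ∈ Finset.range (2 ^ T / 2), hedgeGap η ν best (k + 1) := by
    rw [Finset.range_eq_Ico, Finset.sum_Ico_add' (fun m => hedgeGap η ν best m) 0 (2 ^ T / 2) 1]
    rfl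
  have hηinv : Real.log K / η ≤ 2 * (Real.log K / ε) + 8 * Real.log K := by
    have h1 : 1 / η ≤ 2 / ε + 8 := by
      rw [div_le_iff₀ hη0, hη]
      rcases min_choice (ε / 2) (1 / 8) with h | h
      · rw [h, add_mul, show 2 / ε * (ε / 2) = 1 by field_simp]
        linarith
      · rw [h]
        have : 0 < 2 / ε := by positivity
        linarith
    calc Real.log K / η = Real.log K * (1 / η) := by ring
      _ ≤ Real.log K * (2 / ε + 8) := by gcongr
      _ = _ := by ring
  have hlogΔ : Real.log K ≤ Real.log K / Δ := by
    rw [le_div_iff₀ hΔ]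
    nlinarith
  have hε' : 0 ≤ Real.log K / ε := by positivity
  rw [OnlineAlgorithm.regret_eq_sum]
  have hT : ∑ t ∈ Finset.range T, c t ≤ ∑ t ∈ Finset.range (2 ^ (T + 1) - 1), c t :=
    Finset.sum_le_sum_of_subset_of_nonneg (Finset.range_subset_range.2 hTle) fun t _ _ => hc0 t
  have hsum := sum_hedgeGap_le ν best hK hΔ h hη0 (2 ^ T / 2)
  have hB := hblock T
  rw [hIoc] at hB
  rw [hc] at hT hB
  -- The total is at most `1 + 16 log K / ε + 64 log K + 132 log K / Δ`, where `log K ≤ log K / Δ`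
  -- and `1` is absorbed by `log K ≥ 0.69`.
  linarith

end UpperBound

theorem mainTheorem2 :
    (∀ (K : ℕ) [NeZero K], 2 ≤ K → ∀ ε : ℝ, 0 < ε → ∀ p₀ : PMF (Fin K),
      (randomizedPrefixSoftmax ε p₀).IsDP ε ∧
      ∀ (ν : Measure (LossVector K)) [IsProbabilityMeasure ν] (best : Fin K) (Δ : ℝ),
        HasMinGap ν best Δ → ∀ T : ℕ,
          (randomizedPrefixSoftmax ε p₀).regret ν best T
            ≤ 1000 * (Real.log K / Δ + Real.log K / ε)) ∧
    (∀ δ : ℝ, 0 < δ → δ < 1 → ∃ c : ℝ, 0 < c ∧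
      ∀ K : ℕ, 2 ≤ K → ∀ ε : ℝ, 0 < ε → ∀ Δ : ℝ, 0 < Δ → Δ ≤ 1 →
        (Δ ≤ 1 - δ ∨ ε ≤ 1 / δ) →
        ∀ alg : OnlineAlgorithm K, alg.IsDP ε → ∀ T : ℕ,
          ∃ (p : Fin K → Measure unitInterval) (best : Fin K),
            (∀ j, IsProbabilityMeasure (p j)) ∧
            HasMinGap (Measure.pi p) best Δ ∧
            c * min (T * Δ) (Real.log K / Δ + Real.log K / ε)
              ≤ alg.regret (Measure.pi p) best T) :=
  ⟨fun _ _ hK _ hε p₀ => ⟨randomizedPrefixSoftmax_isDP hε p₀,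
    fun ν _ best _ hgap T => regret_randomizedPrefixSoftmax_le hK hε p₀ ν best hgap T⟩,
    fun _ hδ hδ1 => exists_const_forall_exists_le_regret hδ hδ1⟩
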